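/- **Setting.** Fix integers $k,k^\star\ge 1$, constants $\gamma,R,K\in(0,\infty)$ and a function $K_r:\mathbb R_{\ge0}\to\mathbb R_{\ge0}$. For each sample size $n$ let $p=p(n)\in\mathbb N$ with $p(n)/n\to\gamma$, and let $\mathcal S_p\subseteq\{\theta\in\mathbb R^p:\|\theta\|_2\le R\}$ be a symmetric convex set, $\mathcal C_p\subseteq\mathcal S_p$ a compact set, $\Theta^\star=(\theta^\star_1,\dots,\theta^\star_{k^\star})\in\mathbb R^{p\times k^\star}$ with all $\theta^\star_j\in\mathcal S_p$, $r:\mathbb R^{p\times k}\to\mathbb R$ a regularizer, $\mathbb P_{x}$ a probability law on $\mathbb R^p$, and $\Sigma_g\in\mathbb R^{p\times p}$ positive semidefinite. Let $\ell:\mathbb R^{k+1}\to\mathbb R_{\ge0}$ and $\eta:\mathbb R^{k^\star+1}\to\mathbb R$ be $K$-Lipschitz, and let $\mathbb P_\varepsilon$ be a probability law on $\mathbb R$ (these three do not depend on $n$). With $\|Z\|_{\psi_2}=\inf\{s>0:\mathbb E\,e^{Z^2/s^2}\le2\}$, $x\sim\mathbb P_x$, $g\sim\mathcal N(0,\Sigma_g)$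 and $\varepsilon\sim\mathbb P_\varepsilon$, assume: * $\|\varepsilon\|_{\psi_2}\le K$; * for all $n$ and $B>0$: $|r(\Theta_0)-r(\Theta_1)|\le K_r(B)\|\Theta_0-\Theta_1\|_F$ whenever $\|\Theta_0\|_F,\|\Theta_1\|_F\le B$; * for all $n$ and $\theta\in\mathcal S_p$ with $\|\theta\|_2\le1$: $\|x^{\mathsf T}\theta\|_{\psi_2}\le K$ and $\|\Sigma_g^{1/2}\theta\|_2\le K$; * for every bounded Lipschitz $\varphi:\mathbb R\to\mathbb R$: $\displaystyle\lim_{n\to\infty}\sup_{\theta\in\mathcal S_p}\big|\mathbb E\,\varphi(\theta^{\mathsf T}x)-\mathbb E\,\varphi(\theta^{\mathsf T}g)\big|=0$. Let $X$ have $n$ i.i.d. rows $x_i\sim\mathbb P_x$, let $G$ have $n$ i.i.d. rows $g_i\sim\mathcal N(0,\Sigma_g)$, and let $\varepsilon_1,\dots,\varepsilon_n$ be i.i.d. with law $\mathbb P_\varepsilon$, independent of the features. Put $$\widehat R_n(\Theta;X)=\frac1n\sum_{i=1}^n\ell\big(\Theta^{\mathsf T}x_i;\eta(\Theta^{\star\mathsf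 T}x_i,\varepsilon_i)\big)+r(\Theta),\qquad \mathrm{ERM}_t(X)=\{\Theta\in\mathcal C_p^{k}:\widehat R_n(\Theta;X)\le t\},$$ $$R_n^{x}(\Theta)=\mathbb E\,\ell\big(\Theta^{\mathsf T}x;\eta(\Theta^{\star\mathsf T}x,\varepsilon)\big)\ \text{ with } x,\varepsilon\text{ independent},$$ and define $\widehat R_n(\Theta;G)$, $\mathrm{ERM}_t(G)$, $R_n^{g}(\Theta)$ in the same way with $g_i,g$ in place of $x_i,x$. A minimum over the empty set is $+\infty$. **Theorem.** Assume $\lim_{n\to\infty}\mathbb P(\mathrm{ERM}_0(G)\ne\emptyset)=1$. Then for all $\delta>0$, $\alpha>0$ and $\rho\in\mathbb R$, $$\limsup_{n\to\infty}\Big[\mathbb P\Big(\min_{\Theta\in\mathrm{ERM}_\alpha(X)}R_n^{x}(\Theta)\ge\rho+\delta\Big)-\mathbb P\Big(\min_{\Theta\in\mathrm{ERM}_0(G)}R_n^{g}(\Theta)>\rho\Big)\Big]\le0,$$ $$\limsup_{t\to0}\,\limsup_{n\to\infty}\Big[\mathbb P\Big(\min_{\Theta\in\mathrm{ERM}_t(X)}R_n^{x}(\Theta)\le\rho-\delta\Big)-\mathbb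 P\Big(\min_{\Theta\in\mathrm{ERM}_\alpha(G)}R_n^{g}(\Theta)\le\rho\Big)\Big]\le0.$$ (In particular the first probability is asymptotically at most the second in each line whenever the limits exist.) Consequently the minimum test error over near-interpolators is universal, provided that in the Gaussian model it does not change discontinuously with the accuracy of interpolation: let $\rho\in\mathbb R$, and suppose that for every $\delta>0$ $$\lim_{n\to\infty}\mathbb P\Big(\Big|\min_{\mathrm{ERM}_0(G)}R_n^{g}-\rho\Big|\ge\delta\Big)=0\quad\text{and}\quad\lim_{\alpha\downarrow0}\limsup_{n\to\infty}\mathbb P\Big(\Big|\min_{\mathrm{ERM}_\alpha(G)}R_n^{g}-\rho\Big|\ge\delta\Big)=0;$$ then for every $\delta>0$ $$\lim_{t\downarrow0}\limsup_{n\to\infty}\mathbb P\Big(\Big|\min_{\mathrm{ERM}_t(X)}R_n^{x}-\rho\Big|\ge\delta\Big)=0.$$ -/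

import Mathlib

open MeasureTheory ProbabilityTheory Filter Topology
open scoped NNReal ENNReal RealInnerProductSpace Matrix MatrixOrder

noncomputable section

namespace ERMUniversality

/-- The subgaussian (Orlicz `ψ₂`) norm `inf {s > 0 : E exp (f² / s²) ≤ 2}` of a real random
variable, equal to `∞` if there is no such `s`. -/
def subgaussianNorm {Ω : Type*} [MeasurableSpace Ω] (μ : Measure Ω) (f : Ω → ℝ) : ℝ≥0∞ :=
  ⨅ (s : ℝ≥0) (_ : 0 < s ∧ ∫⁻ ω, ENNReal.ofReal (Real.exp (f ω ^ 2 / (s : ℝ) ^ 2)) ∂μ ≤ 2),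
    (s : ℝ≥0∞)

/-- Parameter matrices `Θ = (θ₁, …, θ_k) ∈ ℝ^{p × k}`, as tuples of columns. The norm of this
type is the Frobenius norm. -/
abbrev Params (p k : ℕ) : Type := PiLp 2 (fun _ : Fin k => EuclideanSpace ℝ (Fin p))

/-- The projection `Θᵀ x ∈ ℝ^k`. -/
def proj {p k : ℕ} (Θ : Params p k) (x : EuclideanSpace ℝ (Fin p)) : EuclideanSpace ℝ (Fin k) :=
  WithLp.toLp 2 (fun j => ⟪Θ j, x⟫)

/-- The data of a sequence, indexed by the sample size `n`, of empirical risk minimization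
problems in dimension `p n`; no property is assumed of them here. -/
structure ERMSequence (k kstar : ℕ) where
  /-- the dimension `p = p(n)` of the features -/
  p : ℕ → ℕ
  /-- the loss `ℓ(u; y)` -/
  loss : EuclideanSpace ℝ (Fin k) → ℝ → ℝ
  /-- the labeling function `η(v, ε)` -/
  label : EuclideanSpace ℝ (Fin kstar) → ℝ → ℝ
  /-- the law of the noise variables `ε_i` -/
  noise : Measure ℝ
  /-- the sets `𝒮_p` of directions -/
  S : ∀ n, Set (EuclideanSpace ℝ (Fin (p n)))
  /-- the constraint sets `𝒞_p` -/
  C : ∀ n, Set (EuclideanSpace ℝ (Fin (p n)))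
  /-- the true parameters `Θ⋆` -/
  truth : ∀ n, Params (p n) kstar
  /-- the regularizer `r` -/
  reg : ∀ n, Params (p n) k → ℝ
  /-- the law of the feature vectors `x_i` -/
  features : ∀ n, Measure (EuclideanSpace ℝ (Fin (p n)))
  /-- the covariance `Σ_g` of the Gaussian feature vectors `g_i` -/
  cov : ∀ n, Matrix (Fin (p n)) (Fin (p n)) ℝ

namespace ERMSequence

variable {k kstar : ℕ} (M : ERMSequence k kstar)

/-- The law `N(0, Σ_g)` of the Gaussian feature vectors. -/
def gaussian (n : ℕ) : Measure (EuclideanSpace ℝ (Fin (M.p n))) :=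
  multivariateGaussian 0 (M.cov n)

/-- A data set: `n` pairs (feature vector, noise variable). -/
abbrev Data (n : ℕ) : Type := Fin n → EuclideanSpace ℝ (Fin (M.p n)) × ℝ

/-- The joint law of `n` i.i.d. pairs (feature vector, noise variable), the feature vector having
law `μ` and being independent of the noise variable. -/
def sampleLaw (n : ℕ) (μ : Measure (EuclideanSpace ℝ (Fin (M.p n)))) : Measure (M.Data n) :=
  Measure.pi (fun _ : Fin n => μ.prod M.noise)

/-- The loss `ℓ(Θᵀ x; η(Θ⋆ᵀ x, ε))` of the parameter `Θ` on a sample `(x, ε)`. -/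
def sampleLoss (n : ℕ) (Θ : Params (M.p n) k) (z : EuclideanSpace ℝ (Fin (M.p n)) × ℝ) : ℝ :=
  M.loss (proj Θ z.1) (M.label (proj (M.truth n) z.1) z.2)

/-- The regularized empirical risk. -/
def empRisk (n : ℕ) (D : M.Data n) (Θ : Params (M.p n) k) : ℝ :=
  (1 / (n : ℝ)) * ∑ i, M.sampleLoss n Θ (D i) + M.reg n Θ

/-- The set `ERM_t` of the `Θ ∈ 𝒞_p^k` of empirical risk at most `t`. -/
def ERM (n : ℕ) (t : ℝ) (D : M.Data n) : Set (Params (M.p n) k) :=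
  {Θ | (∀ j, Θ j ∈ M.C n) ∧ M.empRisk n D Θ ≤ t}

/-- The test error of `Θ` when the feature vector has law `μ`. -/
def testError (n : ℕ) (μ : Measure (EuclideanSpace ℝ (Fin (M.p n)))) (Θ : Params (M.p n) k) : ℝ :=
  ∫ z, M.sampleLoss n Θ z ∂(μ.prod M.noise)

/-- The minimum over `ERM_t` of the test error, in the extended reals: it is `+∞` if `ERM_t`
is empty. -/
def minTestError (n : ℕ) (μ : Measure (EuclideanSpace ℝ (Fin (M.p n)))) (t : ℝ)
    (D : M.Data n) : EReal :=
  ⨅ Θ ∈ M.ERM n t D, (M.testError n μ Θ : EReal)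

/-- The probability that the minimum test error over `ERM_t` has the property `A`, when both the
training features and the test features have law `μ`. -/
def prob (n : ℕ) (μ : Measure (EuclideanSpace ℝ (Fin (M.p n)))) (t : ℝ) (A : EReal → Prop) : ℝ :=
  (M.sampleLaw n μ).real {D | A (M.minTestError n μ t D)}

/-- The standing assumptions, with constants `γ`, `R`, `K` and the function `Kr`. -/
structure Assumptions (γ : ℝ) (R K : ℝ≥0) (Kr : ℝ≥0 → ℝ≥0) : Prop where
  /-- proportional asymptotics -/
  tendsto_ratio : Tendsto (fun n => (M.p n : ℝ) / n) atTop (𝓝 γ)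
  S_convex : ∀ n, Convex ℝ (M.S n)
  S_symm : ∀ n, ∀ θ ∈ M.S n, -θ ∈ M.S n
  S_subset : ∀ n, M.S n ⊆ Metric.closedBall 0 R
  /-- loss and labeling function -/
  loss_nonneg : ∀ u y, 0 ≤ M.loss u y
  loss_lipschitz :
    LipschitzWith K (fun z : WithLp 2 (EuclideanSpace ℝ (Fin k) × ℝ) => M.loss z.fst z.snd)
  label_lipschitz :
    LipschitzWith K (fun z : WithLp 2 (EuclideanSpace ℝ (Fin kstar) × ℝ) => M.label z.fst z.snd)
  /-- constraint set -/
  C_compact : ∀ n, IsCompact (M.C n)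
  C_subset : ∀ n, M.C n ⊆ M.S n
  /-- distribution parameters -/
  truth_mem : ∀ n j, M.truth n j ∈ M.S n
  /-- noise variables -/
  noise_prob : IsProbabilityMeasure M.noise
  noise_subgaussian : subgaussianNorm M.noise id ≤ K
  /-- regularizer -/
  reg_lipschitz : ∀ n, ∀ B : ℝ≥0, 0 < B → ∀ Θ₀ Θ₁ : Params (M.p n) k, ‖Θ₀‖ ≤ B → ‖Θ₁‖ ≤ B →
    |M.reg n Θ₀ - M.reg n Θ₁| ≤ Kr B * ‖Θ₀ - Θ₁‖
  /-- feature vectors -/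
  features_prob : ∀ n, IsProbabilityMeasure (M.features n)
  cov_posSemidef : ∀ n, (M.cov n).PosSemidef
  features_subgaussian : ∀ n, ∀ θ ∈ M.S n, ‖θ‖ ≤ 1 →
    subgaussianNorm (M.features n) (fun x => ⟪θ, x⟫) ≤ K
  cov_bounded : ∀ n, ∀ θ ∈ M.S n, ‖θ‖ ≤ 1 →
    ‖Matrix.toEuclideanCLM (𝕜 := ℝ) (CFC.sqrt (M.cov n)) θ‖ ≤ K
  /-- asymptotic Gaussianity of the projections along `𝒮_p`, uniformly on `𝒮_p` -/
  features_gaussian : ∀ φ : ℝ → ℝ, (∃ L, LipschitzWith L φ) → (∃ B, ∀ u, |φ u| ≤ B) →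
    Tendsto (fun n => ⨆ θ : M.S n,
      |∫ x, φ ⟪(θ : EuclideanSpace ℝ (Fin (M.p n))), x⟫ ∂(M.features n)
        - ∫ g, φ ⟪(θ : EuclideanSpace ℝ (Fin (M.p n))), g⟫ ∂(M.gaussian n)|) atTop (𝓝 0)

end ERMSequence

/-- The extended real `v` is at distance at least `δ` from the real number `ρ`. -/
def Far (ρ δ : ℝ) (v : EReal) : Prop :=
  v ≤ ((ρ - δ : ℝ) : EReal) ∨ ((ρ + δ : ℝ) : EReal) ≤ v

end ERMUniversality

end

/-! Everything follows from one comparison, `universality`. Let `A n` be arbitrary sets of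
parameters with columns in `S n`, and let `t < α`. Then the event that some element of `A n` has
empirical risk at most `t` under one feature law is asymptotically no more likely than the same
event at level `α` under the other law. Since `A n` is arbitrary, the test error can be constrained
directly: take for `A n` the parameters in the constraint set whose Gaussian test error is below a
threshold. Test errors under the two laws are uniformly close (`close_testError`). One direction of
the comparison controls lower tails; the other, after complements, controls upper tails.

To prove `universality`, replace `A n` by a finite net inside it whose cardinality is exponential in
`n` (`exists_gauge_net`, with the closure of the set of directions supplying the gauge). The net
error is controlled because the averages of absolute projections are uniformly bounded with high
probability (`exists_avgProj_le`). The minimum over the net is then replaced by a free energy, with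
error proportional to `1/β`.

Smooth functions of the free energy are compared by exchanging one sample at a time
(`abs_integral_pi_sub_integral_pi_le`). As a function of a single sample, the free energy is exactly
a constant plus `1/(nβ)` times minus the log of a weighted average of Boltzmann factors. The
second-order Taylor error is `O(1/n²)`. The first-order terms of the two laws differ by `o(1/n)`
because those logarithms have nearly equal expectations (`close_log_boltzmann`), uniformly in the
number of parameters and in the weights. This uniformity comes from approximating the truncated
logarithm by a polynomial: the `m`-th power of the average is a convex combination of products of
`m` Boltzmann factors, and each product depends on boundedly many projections.

Joint closeness of boundedly many projections follows from the one-dimensional hypothesis by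
characteristic functions, tightness and Lévy's theorem (`CloseAlong.finite_dimensional`). -/

open scoped BoundedContinuousFunction Pointwise

/-! ### Volumetric nets for the gauge of a symmetric convex set -/

section Covering

variable {E : Type*} [NormedAddCommGroup E] [NormedSpace ℝ E]

theorem Convex.sub_mem_two_smul {T : Set E} (hT : Convex ℝ T) (hsymm : ∀ x ∈ T, -x ∈ T)
    {x y : E} (hx : x ∈ T) (hy : y ∈ T) : x - y ∈ (2 : ℝ) • T := by
  refine ⟨(1 / 2 : ℝ) • x + (1 / 2 : ℝ) • (-y),
    hT hx (hsymm y hy) (by norm_num) (by norm_num) (by norm_num), ?_⟩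
  module

/-- At a common point, `a - b` would be a difference of two points of `(ε/2) • T`, hence in `ε • T`,
up to an error of norm less than `(ε/2)(η + η) = ε * η`. -/
theorem disjoint_vadd_thickening {T : Set E} (hT : Convex ℝ T) (hsymm : ∀ x ∈ T, -x ∈ T)
    {ε η : ℝ} (hε : 0 < ε) {a b : E} (hη : ∀ z ∈ ε • T, ε * η ≤ dist (a - b) z) :
    Disjoint (a +ᵥ (ε / 2) • Metric.thickening η T) (b +ᵥ (ε / 2) • Metric.thickening η T) := by
  rw [Set.disjoint_left]
  rintro _ ⟨_, ⟨u, hu, rfl⟩, rfl⟩ ⟨_, ⟨v, hv, rfl⟩, hw⟩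
  obtain ⟨s, hs, hus⟩ := Metric.mem_thickening_iff.1 hu
  obtain ⟨t, ht, hvt⟩ := Metric.mem_thickening_iff.1 hv
  obtain ⟨z, hz, hzst⟩ := hT.sub_mem_two_smul hsymm ht hs
  have hzst' : (2 : ℝ) • z = t - s := hzst
  have h := hη (ε • z) (Set.smul_mem_smul_set hz)
  have hab : a - b - ε • z = (ε / 2) • ((v - t) - (u - s)) := by
    have hw' : b + (ε / 2) • v = a + (ε / 2) • u := hw
    have : ε • z = (ε / 2) • (t - s) := by rw [← hzst']; module
    rw [this, show a = b + (ε / 2) • v - (ε / 2) • u by rw [hw']; abel]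
    module
  rw [dist_eq_norm, hab, norm_smul, Real.norm_of_nonneg (by positivity)] at h
  have h2 : ‖(v - t) - (u - s)‖ < η + η :=
    (norm_sub_le _ _).trans_lt (add_lt_add (by rwa [← dist_eq_norm]) (by rwa [← dist_eq_norm]))
  nlinarith

theorem vadd_thickening_subset {T : Set E} (hT : Convex ℝ T) {ε η : ℝ} (hε : 0 < ε) {a : E}
    (ha : a ∈ T) :
    a +ᵥ (ε / 2) • Metric.thickening η T ⊆ (1 + ε / 2) • Metric.thickening η T := by
  rintro _ ⟨_, ⟨u, hu, rfl⟩, rfl⟩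
  obtain ⟨s, hs, hus⟩ := Metric.mem_thickening_iff.1 hu
  have hpos : 0 < 1 + ε / 2 := by positivity
  refine ⟨(1 + ε / 2)⁻¹ • (a + (ε / 2) • u), ?_, ?_⟩
  · refine Metric.mem_thickening_iff.2
      ⟨(1 + ε / 2)⁻¹ • a + ((1 + ε / 2)⁻¹ * (ε / 2)) • s, hT ha hs (by positivity) (by positivity)
        (by field_simp), ?_⟩
    have : (1 + ε / 2)⁻¹ • (a + (ε / 2) • u)
        - ((1 + ε / 2)⁻¹ • a + ((1 + ε / 2)⁻¹ * (ε / 2)) • s)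
        = ((1 + ε / 2)⁻¹ * (ε / 2)) • (u - s) := by module
    rw [dist_eq_norm, this, norm_smul, Real.norm_of_nonneg (by positivity)]
    rw [dist_eq_norm] at hus
    have h1 : (1 + ε / 2)⁻¹ * (ε / 2) ≤ 1 := by
      rw [inv_mul_le_iff₀ hpos]; linarith
    exact (mul_le_of_le_one_left (norm_nonneg _) h1).trans_lt hus
  · simp [smul_smul, hpos.ne']

variable [FiniteDimensional ℝ E]

/-- Volumetric bound on the cardinality of a finite set which is separated with respect to the
gauge of a compact symmetric convex set containing it. -/
theorem card_le_of_gauge_separated {T : Set E} (hT : Convex ℝ T) (hsymm : ∀ x ∈ T, -x ∈ T)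
    (hc : IsCompact T) {ε : ℝ} (hε : 0 < ε) (s : Finset E) (hs : ∀ a ∈ s, a ∈ T)
    (hsep : ∀ a ∈ s, ∀ b ∈ s, a ≠ b → a - b ∉ ε • T) :
    (s.card : ℝ) ≤ (1 + 2 / ε) ^ Module.finrank ℝ E := by
  rcases s.eq_empty_or_nonempty with rfl | ⟨a₀, ha₀⟩
  · simp only [Finset.card_empty, Nat.cast_zero]; positivity
  borelize E
  let μ : Measure E := Measure.addHaar
  have hTne : T.Nonempty := ⟨a₀, hs a₀ ha₀⟩
  have hcl : IsClosed (ε • T) := (hc.smul ε).isClosed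
  -- `T` may have empty interior, so volumes are compared for a thickening. A small enough `η`
  -- preserves the separation, because `ε • T` is closed and there are finitely many pairs.
  obtain ⟨η, hη0, hη⟩ : ∃ η : ℝ, 0 < η ∧ ∀ a ∈ s, ∀ b ∈ s, a ≠ b →
      ∀ z ∈ ε • T, ε * η ≤ dist (a - b) z := by
    have hev : ∀ᶠ η : ℝ in 𝓝[>] 0, ∀ a ∈ s, ∀ b ∈ s, a ≠ b →
        ∀ z ∈ ε • T, ε * η ≤ dist (a - b) z := by
      rw [Filter.eventually_all_finset]
      intro a ha
      rw [Filter.eventually_all_finset]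
      intro b hb
      by_cases hab : a = b
      · simp [hab]
      have hpos : 0 < Metric.infDist (a - b) (ε • T) :=
        (hcl.notMem_iff_infDist_pos (hTne.smul_set)).1 (hsep a ha b hb hab)
      have hev : ∀ᶠ η : ℝ in 𝓝[>] 0, η < Metric.infDist (a - b) (ε • T) / ε :=
        eventually_nhdsWithin_of_eventually_nhds (eventually_lt_nhds (by positivity))
      filter_upwards [hev] with η hη _ z hz
      rw [lt_div_iff₀ hε] at hη
      have := Metric.infDist_le_dist_of_mem (x := a - b) hz
      linarith
    exact ((eventually_mem_nhdsWithin.and hev).exists).imp fun η h => ⟨h.1, h.2⟩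
  set U := Metric.thickening η T
  have hUo : IsOpen U := Metric.isOpen_thickening
  have hUpos : μ U ≠ 0 :=
    (hUo.measure_pos μ (hTne.mono (Metric.self_subset_thickening hη0 T))).ne'
  have hUfin : μ U ≠ ∞ := hc.isBounded.thickening.measure_lt_top.ne
  set d := Module.finrank ℝ E
  have hVo : ∀ a : E, IsOpen (a +ᵥ (ε / 2) • U) := fun a =>
    (hUo.smul₀ (by positivity)).vadd a
  have hmeas : ∀ a : E, μ (a +ᵥ (ε / 2) • U) = ENNReal.ofReal ((ε / 2) ^ d) * μ U := by
    intro a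
    rw [measure_vadd, Measure.addHaar_smul, abs_of_nonneg (by positivity)]
  have hI : (s.card : ℝ≥0∞) * (ENNReal.ofReal ((ε / 2) ^ d) * μ U)
      ≤ ENNReal.ofReal ((1 + ε / 2) ^ d) * μ U := by
    calc (s.card : ℝ≥0∞) * (ENNReal.ofReal ((ε / 2) ^ d) * μ U)
        = ∑ a ∈ s, μ (a +ᵥ (ε / 2) • U) := by simp [hmeas]
      _ = μ (⋃ a ∈ s, (a +ᵥ (ε / 2) • U)) := by
          rw [measure_biUnion_finset _ fun a _ => (hVo a).measurableSet]
          intro a ha b hb hab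
          exact disjoint_vadd_thickening hT hsymm hε (hη a ha b hb hab)
      _ ≤ μ ((1 + ε / 2) • U) :=
          measure_mono (Set.iUnion₂_subset fun a ha => vadd_thickening_subset hT hε (hs a ha))
      _ = ENNReal.ofReal ((1 + ε / 2) ^ d) * μ U := by
          rw [Measure.addHaar_smul, abs_of_nonneg (by positivity)]
  rw [← mul_assoc, ENNReal.mul_le_mul_iff_left hUpos hUfin] at hI
  have hJ := ENNReal.toReal_le_of_le_ofReal (by positivity) hI
  rw [ENNReal.toReal_mul, ENNReal.toReal_ofReal (by positivity), ENNReal.toReal_natCast] at hJ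
  have : (1 + 2 / ε) ^ d = (1 + ε / 2) ^ d / (ε / 2) ^ d := by
    rw [← div_pow]; congr 1; field_simp; ring
  rw [this, le_div_iff₀ (by positivity)]
  exact hJ

/-- Covering of a subset of a compact symmetric convex set by translates of a dilate of it. -/
theorem exists_gauge_net {T : Set E} (hT : Convex ℝ T) (hsymm : ∀ x ∈ T, -x ∈ T)
    (hc : IsCompact T) {ε : ℝ} (hε : 0 < ε) {A : Set E} (hA : A ⊆ T) :
    ∃ N : Finset E, (∀ a ∈ N, a ∈ A) ∧ (∀ a ∈ A, ∃ b ∈ N, a - b ∈ ε • T) ∧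
      (N.card : ℝ) ≤ (1 + 2 / ε) ^ Module.finrank ℝ E := by
  classical
  let P : ℕ → Prop := fun m => ∃ s : Finset E, (∀ a ∈ s, a ∈ A) ∧
    (∀ a ∈ s, ∀ b ∈ s, a ≠ b → a - b ∉ ε • T) ∧ s.card = m
  have hbd : ∀ m, P m → m ≤ ⌊(1 + 2 / ε) ^ Module.finrank ℝ E⌋₊ := by
    rintro m ⟨s, hs, hsep, rfl⟩
    exact Nat.le_floor (card_le_of_gauge_separated hT hsymm hc hε s (fun a ha => hA (hs a ha)) hsep)
  have hP0 : P 0 := ⟨∅, by simp⟩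
  -- A separated subset of `A` of maximal cardinality is a net, since an uncovered point could be
  -- added to it. Its points lie in `A` itself, which `universality` relies on.
  obtain ⟨N, hN, hsep, hcard⟩ := Nat.findGreatest_spec (P := P) (Nat.zero_le _) hP0
  refine ⟨N, hN, fun a ha => ?_,
    card_le_of_gauge_separated hT hsymm hc hε N (fun a ha => hA (hN a ha)) hsep⟩
  by_contra! hcon
  have hTz : (0 : E) ∈ T := by
    have := hT (hA ha) (hsymm a (hA ha)) (by norm_num : (0 : ℝ) ≤ 1 / 2)
      (by norm_num : (0 : ℝ) ≤ 1 / 2) (by norm_num)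
    simpa using this
  have haN : a ∉ N := fun h => hcon a h (by simpa using Set.smul_mem_smul_set (a := ε) hTz)
  have hneg : ∀ x, x ∈ ε • T → -x ∈ ε • T := by
    rintro _ ⟨y, hy, rfl⟩
    exact ⟨-y, hsymm y hy, by simp⟩
  have hP : P (N.card + 1) := by
    refine ⟨insert a N, ?_, ?_, Finset.card_insert_of_notMem haN⟩
    · simp only [Finset.mem_insert, forall_eq_or_imp]
      exact ⟨ha, hN⟩
    · intro x hx y hy hxy
      rcases Finset.mem_insert.1 hx with hxa | hxN <;>
        rcases Finset.mem_insert.1 hy with hya | hyN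
      · exact absurd (hxa.trans hya.symm) hxy
      · exact hxa ▸ hcon y hyN
      · intro h
        exact hcon x hxN (by simpa [hya] using hneg _ h)
      · exact hsep x hxN y hyN hxy
  have hle := (Nat.le_findGreatest (hbd _ hP) hP).trans_eq hcard.symm
  exact Nat.not_succ_le_self _ hle

end Covering

/-! ### Replacement of independent samples one at a time -/

section Lindeberg

variable {Z : Type*} [MeasurableSpace Z]

theorem integral_pi_fin_succ {n : ℕ} (μ : Measure Z) [IsProbabilityMeasure μ]
    (f : (Fin (n + 1) → Z) → ℝ) (hf : Measurable f) {B : ℝ} (hB : ∀ D, |f D| ≤ B) :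
    ∫ D, f D ∂(Measure.pi fun _ : Fin (n + 1) => μ)
      = ∫ D, ∫ z, f (Fin.cons z D) ∂μ ∂(Measure.pi fun _ : Fin n => μ) := by
  have h := (measurePreserving_piFinSuccAbove (fun _ : Fin (n + 1) => μ) 0).symm
  rw [← h.integral_comp' (g := f), integral_prod_symm]
  · simp [MeasurableEquiv.piFinSuccAbove, Fin.insertNthEquiv]
  · refine Integrable.of_bound ((hf.comp (MeasurableEquiv.measurable _)).aestronglyMeasurable) B
      (ae_of_all _ fun D => ?_)
    rw [Real.norm_eq_abs]
    exact hB _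

theorem measurable_fin_cons {n : ℕ} :
    Measurable fun q : Z × (Fin n → Z) => (Fin.cons q.1 q.2 : Fin (n + 1) → Z) := by
  refine measurable_pi_lambda _ fun i => ?_
  refine Fin.cases ?_ (fun j => ?_) i
  · simpa using measurable_fst
  · simp only [Fin.cons_succ]
    fun_prop

/-- Lindeberg's replacement principle. -/
theorem abs_integral_pi_sub_integral_pi_le (μ ν : Measure Z) [IsProbabilityMeasure μ]
    [IsProbabilityMeasure ν] {δ B : ℝ} :
    ∀ (n : ℕ) (f : (Fin n → Z) → ℝ), Measurable f → (∀ D, |f D| ≤ B) →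
      (∀ D j, |∫ z, f (Function.update D j z) ∂μ - ∫ z, f (Function.update D j z) ∂ν| ≤ δ) →
      |∫ D, f D ∂(Measure.pi fun _ => μ) - ∫ D, f D ∂(Measure.pi fun _ => ν)| ≤ n * δ := by
  intro n
  induction n with
  | zero =>
    intro f _ _ _
    simp [Measure.pi_of_empty (fun _ : Fin 0 => μ), Measure.pi_of_empty (fun _ : Fin 0 => ν)]
  | succ n ih =>
    intro f hf hB hδ
    have hsm : ∀ (κ : Measure Z) [IsProbabilityMeasure κ],
        Measurable fun D : Fin n → Z => ∫ z, f (Fin.cons z D) ∂κ := fun κ _ =>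
      ((hf.comp (measurable_fin_cons.comp measurable_swap)).stronglyMeasurable.integral_prod_right'
        (ν := κ)).measurable
    have hbd : ∀ (κ : Measure Z) [IsProbabilityMeasure κ] (D : Fin n → Z),
        |∫ z, f (Fin.cons z D) ∂κ| ≤ B := fun κ _ D => by
      have := norm_integral_le_of_norm_le_const (μ := κ) (f := fun z => f (Fin.cons z D)) (C := B)
        (ae_of_all _ fun z => hB _)
      simpa using this
    rw [integral_pi_fin_succ μ f hf hB, integral_pi_fin_succ ν f hf hB]
    have h1 : |∫ D, ∫ z, f (Fin.cons z D) ∂μ ∂(Measure.pi fun _ : Fin n => μ)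
        - ∫ D, ∫ z, f (Fin.cons z D) ∂ν ∂(Measure.pi fun _ : Fin n => μ)| ≤ δ := by
      rw [← integral_sub
        (Integrable.of_bound (hsm μ).aestronglyMeasurable B (ae_of_all _ (hbd μ)))
        (Integrable.of_bound (hsm ν).aestronglyMeasurable B (ae_of_all _ (hbd ν)))]
      have := norm_integral_le_of_norm_le_const (μ := Measure.pi fun _ : Fin n => μ)
        (f := fun D => ∫ z, f (Fin.cons z D) ∂μ - ∫ z, f (Fin.cons z D) ∂ν) (C := δ)
        (ae_of_all _ fun D => by
          obtain ⟨z₀⟩ : Nonempty Z := nonempty_of_isProbabilityMeasure μ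
          simpa using hδ (Fin.cons z₀ D) 0)
      simpa using this
    -- Averaging over the first coordinate keeps the one-coordinate error at most `δ`, by Fubini.
    have h2 := ih (fun D => ∫ z, f (Fin.cons z D) ∂ν) (hsm ν) (hbd ν) (fun D j => by
      have hup : ∀ z w, (Fin.cons z (Function.update D j w) : Fin (n + 1) → Z)
          = Function.update (Fin.cons z D : Fin (n + 1) → Z) j.succ w := fun z w => by
        rw [Fin.cons_update]
      have hm : Measurable fun q : Z × Z => f (Fin.cons q.2 (Function.update D j q.1)) :=
        hf.comp (measurable_fin_cons.comp (measurable_snd.prodMk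
          ((measurable_update D).comp measurable_fst)))
      have hint : ∀ (κ : Measure Z) [IsProbabilityMeasure κ], Integrable (Function.uncurry
          fun w z : Z => f (Fin.cons z (Function.update D j w))) (κ.prod ν) := fun κ _ =>
        Integrable.of_bound hm.aestronglyMeasurable B (ae_of_all _ fun q => hB _)
      have hr : ∀ (κ : Measure Z) [IsProbabilityMeasure κ],
          Integrable (fun z => ∫ w, f (Fin.cons z (Function.update D j w)) ∂κ) ν := fun κ _ =>
        (hint κ).integral_prod_right
      rw [integral_integral_swap (hint μ), integral_integral_swap (hint ν),
        ← integral_sub (hr μ) (hr ν)]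
      have := norm_integral_le_of_norm_le_const (μ := ν)
        (f := fun z => ∫ w, f (Fin.cons z (Function.update D j w)) ∂μ
          - ∫ w, f (Fin.cons z (Function.update D j w)) ∂ν) (C := δ)
        (ae_of_all _ fun z => by simpa [hup] using hδ (Fin.cons z D) j.succ)
      simpa using this)
    push_cast
    calc _ ≤ _ := abs_sub_le _ (∫ D, ∫ z, f (Fin.cons z D) ∂ν ∂(Measure.pi fun _ : Fin n => μ)) _
      _ ≤ δ + n * δ := add_le_add h1 h2
      _ = _ := by ring

end Lindeberg

/-! ### A smooth cutoff -/

/-- A smooth function decreasing from `1` to `0` between two thresholds, with a quadratic bound on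
the remainder of its first order expansions. -/
theorem exists_smooth_step {a b : ℝ} (hab : a < b) :
    ∃ (ψ ψ' : ℝ → ℝ) (C : ℝ), 0 ≤ C ∧ Continuous ψ ∧ (∀ x, 0 ≤ ψ x ∧ ψ x ≤ 1) ∧
      (∀ x ≤ a, ψ x = 1) ∧ (∀ x, b ≤ x → ψ x = 0) ∧ (∀ x, |ψ' x| ≤ C) ∧
      ∀ x h, |ψ (x + h) - ψ x - ψ' x * h| ≤ C * h ^ 2 := by
  set ψ : ℝ → ℝ := fun x => Real.smoothTransition ((b - x) / (b - a)) with hψ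
  have hba : 0 < b - a := sub_pos.2 hab
  have hsm : ContDiff ℝ 2 ψ := Real.smoothTransition.contDiff.comp (by fun_prop)
  have hone : ∀ x ≤ a, ψ x = 1 := fun x hx =>
    Real.smoothTransition.one_of_one_le ((one_le_div hba).2 (by linarith))
  have hzero : ∀ x, b ≤ x → ψ x = 0 := fun x hx =>
    Real.smoothTransition.zero_of_nonpos (div_nonpos_of_nonpos_of_nonneg (by linarith) hba.le)
  have hd1 : ContDiff ℝ 1 (deriv ψ) := by
    have : ContDiff ℝ (1 + 1) ψ := hsm
    exact (contDiff_succ_iff_deriv.1 this).2.2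
  have hcs : HasCompactSupport (deriv ψ) := by
    refine HasCompactSupport.intro (isCompact_Icc (a := a) (b := b)) fun x hx => ?_
    rw [Set.mem_Icc, not_and_or, not_le, not_le] at hx
    rcases hx with hx | hx
    · have : ψ =ᶠ[𝓝 x] fun _ => 1 := by
        filter_upwards [eventually_lt_nhds hx] with y hy using hone y hy.le
      rw [this.deriv_eq]; simp
    · have : ψ =ᶠ[𝓝 x] fun _ => 0 := by
        filter_upwards [eventually_gt_nhds hx] with y hy using hzero y hy.le
      rw [this.deriv_eq]; simp
  obtain ⟨L, hL⟩ := ContDiff.lipschitzWith_of_hasCompactSupport hcs hd1 one_ne_zero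
  obtain ⟨C, hC⟩ := hd1.continuous.bounded_above_of_compact_support hcs
  refine ⟨ψ, deriv ψ, max C L, le_max_of_le_right L.2, hsm.continuous,
    fun x => ⟨Real.smoothTransition.nonneg _, Real.smoothTransition.le_one _⟩, hone, hzero,
    fun x => (hC x).trans (le_max_left _ _), fun x h => ?_⟩
  have hdiff : Differentiable ℝ ψ := hsm.differentiable (by norm_num)
  -- Mean value inequality for `ψ` minus its linear part at `x`: on the segment the derivative of
  -- this difference is at most `L * |h|`.
  have key := Convex.norm_image_sub_le_of_norm_deriv_le (𝕜 := ℝ)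
    (f := fun y => ψ y - deriv ψ x * y) (s := Set.uIcc x (x + h)) (C := L * |h|)
    (x := x) (y := x + h)
    (fun y _ => (hdiff y).sub ((differentiableAt_id).const_mul _))
    (fun y hy => by
      have hder : deriv (fun y => ψ y - deriv ψ x * y) y = deriv ψ y - deriv ψ x := by
        have := (hdiff y).hasDerivAt.sub ((hasDerivAt_id y).const_mul (deriv ψ x))
        rw [mul_one] at this
        exact this.deriv
      rw [hder, ← dist_eq_norm]
      refine (hL.dist_le_mul y x).trans (mul_le_mul_of_nonneg_left ?_ L.2)
      rw [Real.dist_eq]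
      have := Set.abs_sub_left_of_mem_uIcc hy
      simpa using this)
    (convex_uIcc _ _) Set.left_mem_uIcc Set.right_mem_uIcc
  have e1 : ψ (x + h) - deriv ψ x * (x + h) - (ψ x - deriv ψ x * x)
      = ψ (x + h) - ψ x - deriv ψ x * h := by ring
  rw [e1, add_sub_cancel_left, Real.norm_eq_abs, Real.norm_eq_abs, mul_assoc, abs_mul_abs_self]
    at key
  refine key.trans ?_
  rw [← sq]
  exact mul_le_mul_of_nonneg_right (le_max_right _ _) (sq_nonneg _)

/-! ### Finite families of projections and their characteristic functions -/

section Projections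

variable {E ι : Type*} [NormedAddCommGroup E] [InnerProductSpace ℝ E] [Fintype ι]

/-- The vector of the inner products with the members of a finite family. -/
noncomputable def innerVec (θ : ι → E) (x : E) : EuclideanSpace ℝ ι :=
  WithLp.toLp 2 fun i => ⟪θ i, x⟫

omit [Fintype ι] in
theorem continuous_innerVec (θ : ι → E) : Continuous (innerVec θ) := by
  unfold innerVec
  fun_prop

theorem norm_innerVec_sq (θ : ι → E) (x : E) : ‖innerVec θ x‖ ^ 2 = ∑ i, ⟪θ i, x⟫ ^ 2 := by
  simp [innerVec, EuclideanSpace.real_norm_sq_eq]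

theorem inner_innerVec (θ : ι → E) (x : E) (t : EuclideanSpace ℝ ι) :
    ⟪innerVec θ x, t⟫ = ⟪∑ i, t i • θ i, x⟫ := by
  simp [innerVec, PiLp.inner_apply, sum_inner, real_inner_smul_left]

/-- A linear combination of elements of a symmetric convex set, divided by a bound on the absolute
sum of the coefficients, belongs to the set. -/
theorem Convex.inv_smul_sum_mem {S : Set E} (hS : Convex ℝ S) (hsymm : ∀ x ∈ S, -x ∈ S)
    (h0 : (0 : E) ∈ S) (θ : ι → E) (hθ : ∀ i, θ i ∈ S) (t : ι → ℝ) :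
    (1 + ∑ i, |t i|)⁻¹ • ∑ i, t i • θ i ∈ S := by
  set s := 1 + ∑ i, |t i| with hs
  have hnn : 0 ≤ ∑ i, |t i| := Finset.sum_nonneg fun i _ => abs_nonneg _
  have hs0 : 0 < s := by positivity
  -- The extra index carries the point `0` with weight `s⁻¹`, which brings the total weight to one;
  -- signs are absorbed by symmetry.
  have h := hS.sum_mem (t := (Finset.univ : Finset (Option ι)))
    (w := fun o => o.elim s⁻¹ fun i => s⁻¹ * |t i|)
    (z := fun o => o.elim 0 fun i => if 0 ≤ t i then θ i else -θ i)
    (by rintro (_ | i) _ <;> simp <;> positivity)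
    (by
      rw [Fintype.sum_option]
      simp only [Option.elim]
      rw [← Finset.mul_sum, ← mul_one_add, ← hs, inv_mul_cancel₀ hs0.ne'])
    (by
      rintro (_ | i) _
      · exact h0
      · simp only [Option.elim]
        split_ifs
        · exact hθ i
        · exact hsymm _ (hθ i))
  rw [Fintype.sum_option] at h
  convert h using 1
  simp only [Option.elim, smul_zero, zero_add]
  rw [Finset.smul_sum]
  refine Finset.sum_congr rfl fun i _ => ?_
  split_ifs with hi
  · rw [abs_of_nonneg hi, smul_smul]
  · rw [abs_of_neg (not_le.1 hi), smul_neg, smul_smul]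
    module

variable [MeasurableSpace E] [BorelSpace E]

theorem charFun_map_innerVec (μ : Measure E) (θ : ι → E) (t : EuclideanSpace ℝ ι) :
    charFun (μ.map (innerVec θ)) t
      = ∫ x, Complex.exp ((⟪∑ i, t i • θ i, x⟫ : ℝ) * Complex.I) ∂μ := by
  rw [charFun_apply, integral_map (continuous_innerVec θ).measurable.aemeasurable
    (Continuous.aestronglyMeasurable (by fun_prop))]
  simp_rw [inner_innerVec]

theorem integral_exp_mul_I_eq (μ : Measure E) [IsProbabilityMeasure μ] (v : E) :
    ∫ x, Complex.exp ((⟪v, x⟫ : ℝ) * Complex.I) ∂μ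
      = (∫ x, Real.cos ⟪v, x⟫ ∂μ : ℝ) + (∫ x, Real.sin ⟪v, x⟫ ∂μ : ℝ) * Complex.I := by
  have hc : Integrable (fun x => Real.cos ⟪v, x⟫) μ :=
    Integrable.of_bound (Continuous.aestronglyMeasurable (by fun_prop)) 1
      (ae_of_all _ fun x => Real.abs_cos_le_one _)
  have hs : Integrable (fun x => Real.sin ⟪v, x⟫) μ :=
    Integrable.of_bound (Continuous.aestronglyMeasurable (by fun_prop)) 1
      (ae_of_all _ fun x => Real.abs_sin_le_one _)
  rw [← integral_complex_ofReal, ← integral_complex_ofReal, ← integral_mul_const,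
    ← integral_add hc.ofReal (hs.ofReal.mul_const _)]
  congr 1 with x
  rw [Complex.exp_mul_I, Complex.ofReal_cos, Complex.ofReal_sin]

/-- Markov's inequality for the squared norm: the mass outside the ball of radius `r` is at most `C
/ r ^ 2`. -/
theorem isTightMeasureSet_of_lintegral_sq_le (A : Set (Measure (EuclideanSpace ℝ ι))) (C : ℝ≥0)
    (hA : ∀ μ ∈ A, ∫⁻ x, ENNReal.ofReal (‖x‖ ^ 2) ∂μ ≤ C) : IsTightMeasureSet A := by
  apply isTightMeasureSet_of_tendsto_measure_norm_gt
  have hlim : Tendsto (fun r : ℝ => (C : ℝ≥0∞) / ENNReal.ofReal (r ^ 2)) atTop (𝓝 0) := by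
    have h1 : Tendsto (fun r : ℝ => ENNReal.ofReal (r ^ 2)) atTop (𝓝 ∞) :=
      ENNReal.tendsto_ofReal_atTop.comp (tendsto_pow_atTop two_ne_zero)
    have h2 := ENNReal.Tendsto.const_div (a := (C : ℝ≥0∞)) h1 (Or.inr ENNReal.coe_ne_top)
    simpa using h2
  refine tendsto_of_tendsto_of_tendsto_of_le_of_le' tendsto_const_nhds hlim
    (Eventually.of_forall fun _ => zero_le) ?_
  filter_upwards [eventually_gt_atTop 0] with r hr
  refine iSup₂_le fun μ hμ => ?_
  refine le_trans (measure_mono fun x hx => ?_)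
    ((meas_ge_le_lintegral_div (μ := μ) (f := fun x => ENNReal.ofReal (‖x‖ ^ 2))
      (Continuous.measurable (by fun_prop)).ennreal_ofReal.aemeasurable
      (ε := ENNReal.ofReal (r ^ 2)) (by simpa using hr.ne') ENNReal.ofReal_ne_top).trans (ENNReal.div_le_div_right (hA μ hμ) _))
  have hx' : r < ‖x‖ := hx
  exact ENNReal.ofReal_le_ofReal (by gcongr)

end Projections

/-! ### From one-dimensional to finite-dimensional closeness -/

section UniformCloseness

variable {p : ℕ → ℕ}

/-- Closeness of two sequences of laws along the one-dimensional projections in a sequence of sets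
`S n`, uniform on these sets. -/
def CloseAlong (S : ∀ n, Set (EuclideanSpace ℝ (Fin (p n))))
    (P Q : ∀ n, Measure (EuclideanSpace ℝ (Fin (p n)))) : Prop :=
  ∀ φ : ℝ → ℝ, (∃ L, LipschitzWith L φ) → (∃ B, ∀ u, |φ u| ≤ B) → ∀ ε > 0,
    ∀ᶠ n in atTop, ∀ θ ∈ S n, |∫ x, φ ⟪θ, x⟫ ∂(P n) - ∫ x, φ ⟪θ, x⟫ ∂(Q n)| ≤ ε

variable {S : ∀ n, Set (EuclideanSpace ℝ (Fin (p n)))}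
  {P Q : ∀ n, Measure (EuclideanSpace ℝ (Fin (p n)))}
  [∀ n, IsProbabilityMeasure (P n)] [∀ n, IsProbabilityMeasure (Q n)]

omit [∀ n, IsProbabilityMeasure (P n)] [∀ n, IsProbabilityMeasure (Q n)] in
theorem CloseAlong.symm (h : CloseAlong S P Q) : CloseAlong S Q P := fun φ hL hB ε hε => by
  filter_upwards [h φ hL hB ε hε] with n hn θ hθ
  rw [abs_sub_comm]
  exact hn θ hθ

/-- With `s = 1 + ∑ |t i|`, the combination `∑ t i • θ i` is `s` times an element of `S n`. The
characteristic function at `t` is therefore made of expectations of `cos (s u)` and `sin (s u)`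
along a direction of `S n`. These test functions depend neither on `n` nor on `θ`, which gives
uniformity. -/
theorem CloseAlong.norm_charFun_sub_le (h : CloseAlong S P Q) (hconv : ∀ n, Convex ℝ (S n))
    (hsymm : ∀ n, ∀ θ ∈ S n, -θ ∈ S n) (h0 : ∀ n, 0 ∈ S n) {ι : Type*} [Fintype ι]
    (t : EuclideanSpace ℝ ι) {ε : ℝ} (hε : 0 < ε) :
    ∀ᶠ n in atTop, ∀ θ : ι → EuclideanSpace ℝ (Fin (p n)), (∀ i, θ i ∈ S n) →
      ‖charFun ((P n).map (innerVec θ)) t - charFun ((Q n).map (innerVec θ)) t‖ ≤ ε := by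
  set s := 1 + ∑ i, |t i| with hs
  have hs0 : 0 < s := by
    have : 0 ≤ ∑ i, |t i| := Finset.sum_nonneg fun i _ => abs_nonneg _
    positivity
  have hlip : ∀ f : ℝ → ℝ, LipschitzWith 1 f → ∃ L, LipschitzWith L fun u => f (s * u) :=
    fun f hf => ⟨_, hf.comp (lipschitzWith_smul s)⟩
  filter_upwards [
    h (fun u => Real.cos (s * u)) (hlip _ Real.lipschitzWith_cos)
      ⟨1, fun u => Real.abs_cos_le_one _⟩ (ε / 2) (by positivity),
    h (fun u => Real.sin (s * u)) (hlip _ Real.lipschitzWith_sin)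
      ⟨1, fun u => Real.abs_sin_le_one _⟩ (ε / 2) (by positivity)] with n hc hsn θ hθ
  have hmem := (hconv n).inv_smul_sum_mem (hsymm n) (h0 n) θ hθ t
  have hc' := hc _ hmem
  have hs' := hsn _ hmem
  have e : ∀ x : EuclideanSpace ℝ (Fin (p n)),
      s * ⟪(1 + ∑ i, |t i|)⁻¹ • ∑ i, t i • θ i, x⟫ = ⟪∑ i, t i • θ i, x⟫ := fun x => by
    rw [real_inner_smul_left, ← hs, mul_inv_cancel_left₀ hs0.ne']
  simp only [e] at hc' hs'
  rw [charFun_map_innerVec, charFun_map_innerVec, integral_exp_mul_I_eq, integral_exp_mul_I_eq]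
  set a := ∫ x, Real.cos ⟪∑ i, t i • θ i, x⟫ ∂(P n)
  set b := ∫ x, Real.cos ⟪∑ i, t i • θ i, x⟫ ∂(Q n)
  set c := ∫ x, Real.sin ⟪∑ i, t i • θ i, x⟫ ∂(P n)
  set d := ∫ x, Real.sin ⟪∑ i, t i • θ i, x⟫ ∂(Q n)
  have : (a : ℂ) + c * Complex.I - (b + d * Complex.I)
      = ((a - b : ℝ) : ℂ) + ((c - d : ℝ) : ℂ) * Complex.I := by push_cast; ring
  rw [this]
  refine (norm_add_le _ _).trans ?_
  rw [norm_mul, Complex.norm_I, mul_one, Complex.norm_real, Complex.norm_real, Real.norm_eq_abs,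
    Real.norm_eq_abs]
  linarith

/-- Closeness along one-dimensional projections implies closeness along finite-dimensional
projections. -/
theorem CloseAlong.finite_dimensional (h : CloseAlong S P Q) (hconv : ∀ n, Convex ℝ (S n))
    (hsymm : ∀ n, ∀ θ ∈ S n, -θ ∈ S n) (h0 : ∀ n, 0 ∈ S n) (C : ℝ≥0)
    (hC : ∀ n, ∀ θ ∈ S n, ∫⁻ x, ENNReal.ofReal (⟪θ, x⟫ ^ 2) ∂(P n) ≤ C)
    {ι : Type*} [Fintype ι] (φ : EuclideanSpace ℝ ι →ᵇ ℝ) {ε : ℝ} (hε : 0 < ε) :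
    ∀ᶠ n in atTop, ∀ θ : ι → EuclideanSpace ℝ (Fin (p n)), (∀ i, θ i ∈ S n) →
      |∫ x, φ (innerVec θ x) ∂(P n) - ∫ x, φ (innerVec θ x) ∂(Q n)| ≤ ε := by
  by_contra hcon
  have hfr : ∃ᶠ n in atTop, ∃ θ : ι → EuclideanSpace ℝ (Fin (p n)), (∀ i, θ i ∈ S n) ∧
      ε < |∫ x, φ (innerVec θ x) ∂(P n) - ∫ x, φ (innerVec θ x) ∂(Q n)| := by
    intro hev
    apply hcon
    filter_upwards [hev] with n hn θ hθ
    by_contra! hlt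
    exact hn ⟨θ, hθ, hlt⟩
  -- Failure of uniformity yields a subsequence with bad directions; all the projected laws live on
  -- the same Euclidean space, where compactness applies.
  obtain ⟨ns, hns, hbad⟩ := extraction_of_frequently_atTop hfr
  choose θ hθ hbad using hbad
  have hmeas : ∀ m, AEMeasurable (innerVec (θ m)) (P (ns m)) := fun m =>
    (continuous_innerVec _).measurable.aemeasurable
  have hmeas' : ∀ m, AEMeasurable (innerVec (θ m)) (Q (ns m)) := fun m =>
    (continuous_innerVec _).measurable.aemeasurable
  let a : ℕ → ProbabilityMeasure (EuclideanSpace ℝ ι) := fun m =>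
    ⟨(P (ns m)).map (innerVec (θ m)), Measure.isProbabilityMeasure_map (hmeas m)⟩
  let b : ℕ → ProbabilityMeasure (EuclideanSpace ℝ ι) := fun m =>
    ⟨(Q (ns m)).map (innerVec (θ m)), Measure.isProbabilityMeasure_map (hmeas' m)⟩
  have htight : IsTightMeasureSet
      {((μ : ProbabilityMeasure (EuclideanSpace ℝ ι)) : Measure (EuclideanSpace ℝ ι)) |
        μ ∈ Set.range a} := by
    apply isTightMeasureSet_of_lintegral_sq_le _ (Fintype.card ι * C)
    rintro _ ⟨_, ⟨m, rfl⟩, rfl⟩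
    change ∫⁻ x, ENNReal.ofReal (‖x‖ ^ 2) ∂((P (ns m)).map (innerVec (θ m))) ≤ _
    rw [lintegral_map' (Continuous.measurable (by fun_prop)).ennreal_ofReal.aemeasurable (hmeas m)]
    simp_rw [norm_innerVec_sq]
    calc _ = ∫⁻ x, ∑ i, ENNReal.ofReal (⟪θ m i, x⟫ ^ 2) ∂(P (ns m)) := by
          simp_rw [ENNReal.ofReal_sum_of_nonneg fun i _ => sq_nonneg _]
      _ = ∑ i, ∫⁻ x, ENNReal.ofReal (⟪θ m i, x⟫ ^ 2) ∂(P (ns m)) :=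
          lintegral_finsetSum _ fun i _ =>
            (Continuous.measurable (by fun_prop)).ennreal_ofReal
      _ ≤ ∑ _i : ι, (C : ℝ≥0∞) := Finset.sum_le_sum fun i _ => hC _ _ (hθ m i)
      _ = _ := by simp
  obtain ⟨μ, -, l, hl, hμ⟩ :=
    (isCompact_closure_of_isTightMeasureSet htight).tendsto_subseq (x := a)
      fun m => subset_closure ⟨m, rfl⟩
  -- Tightness is needed for the `P`-laws only: the `Q`-laws have the same limiting characteristic
  -- function, so Lévy's theorem gives them the same limit.
  have hν : Tendsto (b ∘ l) atTop (𝓝 μ) := by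
    refine ProbabilityMeasure.tendsto_of_tendsto_charFun fun t => ?_
    have h1 := ProbabilityMeasure.tendsto_iff_tendsto_charFun.1 hμ t
    have h2 : Tendsto (fun m => charFun ((b ∘ l) m : Measure (EuclideanSpace ℝ ι)) t
        - charFun ((a ∘ l) m : Measure (EuclideanSpace ℝ ι)) t) atTop (𝓝 0) := by
      rw [Metric.tendsto_atTop']
      intro δ hδ
      have := (hns.comp hl).tendsto_atTop.eventually
        (h.norm_charFun_sub_le hconv hsymm h0 t (half_pos hδ))
      obtain ⟨N, hN⟩ := eventually_atTop.1 this
      refine ⟨N, fun m hm => ?_⟩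
      rw [dist_zero_right, norm_sub_rev]
      exact (hN m hm.le _ (hθ (l m))).trans_lt (half_lt_self hδ)
    simpa using h2.add h1
  have hi1 := ProbabilityMeasure.tendsto_iff_forall_integral_tendsto.1 hμ φ
  have hi2 := ProbabilityMeasure.tendsto_iff_forall_integral_tendsto.1 hν φ
  have hd := (hi1.sub hi2).abs
  rw [sub_self, abs_zero] at hd
  obtain ⟨m, hm⟩ := (hd.eventually (eventually_lt_nhds hε)).exists
  refine lt_irrefl ε ((hbad (l m)).trans ?_)
  change |∫ x, φ x ∂((P (ns (l m))).map (innerVec (θ (l m))))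
    - ∫ x, φ x ∂((Q (ns (l m))).map (innerVec (θ (l m))))| < ε at hm
  rwa [integral_map (hmeas _) φ.continuous.aestronglyMeasurable,
    integral_map (hmeas' _) φ.continuous.aestronglyMeasurable] at hm

end UniformCloseness

/-! ### Moments of subgaussian variables -/

section Subgaussian

open ERMUniversality

variable {Ω : Type*} [MeasurableSpace Ω] {μ : Measure Ω} {f : Ω → ℝ} {c : ℝ}

theorem lintegral_exp_sq_le_of_subgaussianNorm_lt {c : ℝ≥0} (h : subgaussianNorm μ f < c) :
    ∫⁻ ω, ENNReal.ofReal (Real.exp (f ω ^ 2 / (c : ℝ) ^ 2)) ∂μ ≤ 2 := by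
  simp only [subgaussianNorm, iInf_lt_iff] at h
  obtain ⟨s, ⟨hs0, hs⟩, hsc⟩ := h
  have hsc' : (s : ℝ) ≤ c := by exact_mod_cast (ENNReal.coe_lt_coe.1 hsc).le
  have hs0' : (0 : ℝ) < s := hs0
  refine (lintegral_mono fun ω => ENNReal.ofReal_le_ofReal (Real.exp_le_exp.2 ?_)).trans hs
  gcongr

/-- Integrating `y + 1 ≤ exp y` at `y = f² / c²` gives `E y + 1 ≤ 2`. -/
theorem lintegral_sq_le_of_lintegral_exp_sq_le [IsProbabilityMeasure μ] (hc : 0 < c)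
    (h : ∫⁻ ω, ENNReal.ofReal (Real.exp (f ω ^ 2 / c ^ 2)) ∂μ ≤ 2) :
    ∫⁻ ω, ENNReal.ofReal (f ω ^ 2) ∂μ ≤ ENNReal.ofReal (c ^ 2) := by
  have h1 : ∫⁻ ω, ENNReal.ofReal (f ω ^ 2 / c ^ 2) ∂μ + 1 ≤ 1 + 1 := by
    calc ∫⁻ ω, ENNReal.ofReal (f ω ^ 2 / c ^ 2) ∂μ + 1
        = ∫⁻ ω, (ENNReal.ofReal (f ω ^ 2 / c ^ 2) + 1) ∂μ := by
          rw [lintegral_add_right _ measurable_const]; simp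
      _ ≤ ∫⁻ ω, ENNReal.ofReal (Real.exp (f ω ^ 2 / c ^ 2)) ∂μ := by
          refine lintegral_mono fun ω => ?_
          rw [← ENNReal.ofReal_one, ← ENNReal.ofReal_add (by positivity) zero_le_one]
          exact ENNReal.ofReal_le_ofReal (Real.add_one_le_exp _)
      _ ≤ 1 + 1 := by rwa [one_add_one_eq_two]
  have h2 : ∫⁻ ω, ENNReal.ofReal (f ω ^ 2 / c ^ 2) ∂μ ≤ 1 :=
    (ENNReal.add_le_add_iff_right ENNReal.one_ne_top).1 h1
  calc ∫⁻ ω, ENNReal.ofReal (f ω ^ 2) ∂μ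
      = ∫⁻ ω, ENNReal.ofReal (c ^ 2) * ENNReal.ofReal (f ω ^ 2 / c ^ 2) ∂μ := by
        congr 1 with ω
        rw [← ENNReal.ofReal_mul (by positivity)]
        congr 1
        field_simp
    _ = ENNReal.ofReal (c ^ 2) * ∫⁻ ω, ENNReal.ofReal (f ω ^ 2 / c ^ 2) ∂μ :=
        lintegral_const_mul' _ _ ENNReal.ofReal_ne_top
    _ ≤ ENNReal.ofReal (c ^ 2) := mul_le_of_le_one_right' h2

theorem integrable_sq_of_lintegral_sq_le {C : ℝ} (hf : AEStronglyMeasurable f μ) (hC : 0 ≤ C)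
    (h : ∫⁻ ω, ENNReal.ofReal (f ω ^ 2) ∂μ ≤ ENNReal.ofReal C) :
    Integrable (fun ω => f ω ^ 2) μ ∧ ∫ ω, f ω ^ 2 ∂μ ≤ C := by
  have hnn : 0 ≤ᵐ[μ] fun ω => f ω ^ 2 := ae_of_all _ fun ω => sq_nonneg _
  refine ⟨⟨hf.pow 2, ?_⟩, ?_⟩
  · rw [hasFiniteIntegral_iff_ofReal hnn]
    exact h.trans_lt ENNReal.ofReal_lt_top
  · rw [integral_eq_lintegral_of_nonneg_ae hnn (hf.pow 2)]
    exact ENNReal.toReal_le_of_le_ofReal hC h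

end Subgaussian

/-! ### Growth, moments and uniform closeness of the losses -/

namespace ERMUniversality.ERMSequence

variable {k kstar : ℕ} (M : ERMSequence k kstar)

/-- The feature laws considered here: probability laws whose one-dimensional projections along the
sets of directions are uniformly subgaussian. -/
structure Admissible (c : ℝ) (P : ∀ n, Measure (EuclideanSpace ℝ (Fin (M.p n)))) : Prop where
  prob : ∀ n, IsProbabilityMeasure (P n)
  subgaussian : ∀ n, ∀ θ ∈ M.S n,
    ∫⁻ x, ENNReal.ofReal (Real.exp (⟪θ, x⟫ ^ 2 / c ^ 2)) ∂(P n) ≤ 2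

variable {M} {γ : ℝ} {R K : ℝ≥0} {Kr : ℝ≥0 → ℝ≥0}

theorem dist_withLp_two_le {E : Type*} [NormedAddCommGroup E] (u u' : E) (y y' : ℝ) :
    dist (WithLp.toLp 2 (u, y)) (WithLp.toLp 2 (u', y')) ≤ ‖u - u'‖ + |y - y'| := by
  rw [WithLp.prod_dist_eq_of_L2]
  simp only [dist_eq_norm, Real.norm_eq_abs, WithLp.toLp_fst, WithLp.toLp_snd]
  refine Real.sqrt_le_iff.2 ⟨by positivity, ?_⟩
  nlinarith [norm_nonneg (u - u'), abs_nonneg (y - y'),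
    mul_nonneg (norm_nonneg (u - u')) (abs_nonneg (y - y'))]

namespace Assumptions

variable (hM : M.Assumptions γ R K Kr)
include hM

theorem abs_loss_sub_le (u u' : EuclideanSpace ℝ (Fin k)) (y y' : ℝ) :
    |M.loss u y - M.loss u' y'| ≤ K * (‖u - u'‖ + |y - y'|) := by
  have h := hM.loss_lipschitz.dist_le_mul (WithLp.toLp 2 (u, y)) (WithLp.toLp 2 (u', y'))
  rw [Real.dist_eq] at h
  exact h.trans (mul_le_mul_of_nonneg_left (dist_withLp_two_le _ _ _ _) K.2)

theorem abs_label_sub_le (u u' : EuclideanSpace ℝ (Fin kstar)) (y y' : ℝ) :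
    |M.label u y - M.label u' y'| ≤ K * (‖u - u'‖ + |y - y'|) := by
  have h := hM.label_lipschitz.dist_le_mul (WithLp.toLp 2 (u, y)) (WithLp.toLp 2 (u', y'))
  rw [Real.dist_eq] at h
  exact h.trans (mul_le_mul_of_nonneg_left (dist_withLp_two_le _ _ _ _) K.2)

theorem continuous_lossLabel : Continuous
    fun q : EuclideanSpace ℝ (Fin k) × EuclideanSpace ℝ (Fin kstar) × ℝ =>
      M.loss q.1 (M.label q.2.1 q.2.2) := by
  have h1 : Continuous fun q : EuclideanSpace ℝ (Fin kstar) × ℝ => M.label q.1 q.2 :=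
    hM.label_lipschitz.continuous.comp
      (WithLp.prod_continuous_toLp 2 (EuclideanSpace ℝ (Fin kstar)) ℝ)
  have h2 : Continuous fun q : EuclideanSpace ℝ (Fin k) × ℝ => M.loss q.1 q.2 :=
    hM.loss_lipschitz.continuous.comp (WithLp.prod_continuous_toLp 2 (EuclideanSpace ℝ (Fin k)) ℝ)
  exact h2.comp (continuous_fst.prodMk (h1.comp continuous_snd))

omit hM in
theorem continuous_proj {p l : ℕ} (Θ : Params p l) : Continuous (proj Θ) :=
  continuous_innerVec fun j => Θ j

theorem continuous_sampleLoss (n : ℕ) (Θ : Params (M.p n) k) : Continuous (M.sampleLoss n Θ) :=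
  hM.continuous_lossLabel.comp ((continuous_proj Θ |>.comp continuous_fst).prodMk
    (((continuous_proj (M.truth n)).comp continuous_fst).prodMk continuous_snd))

theorem sampleLoss_nonneg (n : ℕ) (Θ : Params (M.p n) k) (z) : 0 ≤ M.sampleLoss n Θ z :=
  hM.loss_nonneg _ _

omit hM in
theorem norm_toLp_le_sum {l : ℕ} (v : Fin l → ℝ) :
    ‖(WithLp.toLp 2 v : EuclideanSpace ℝ (Fin l))‖ ≤ ∑ j, |v j| := by
  rw [EuclideanSpace.norm_eq]
  refine Real.sqrt_le_iff.2 ⟨Finset.sum_nonneg fun j _ => abs_nonneg _, ?_⟩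
  simpa using Finset.sum_sq_le_sq_sum_of_nonneg (s := Finset.univ) (f := fun j => |v j|)
    fun j _ => abs_nonneg _

theorem abs_sampleLoss_sub_le (n : ℕ) (Θ Θ' : Params (M.p n) k) (z) :
    |M.sampleLoss n Θ z - M.sampleLoss n Θ' z| ≤ K * ∑ j, |⟪(Θ - Θ') j, z.1⟫| := by
  refine (hM.abs_loss_sub_le _ _ _ _).trans (mul_le_mul_of_nonneg_left ?_ K.2)
  rw [sub_self, abs_zero, add_zero]
  have : proj Θ z.1 - proj Θ' z.1 = WithLp.toLp 2 fun j => ⟪(Θ - Θ') j, z.1⟫ := by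
    ext j
    simp [proj, inner_sub_left]
  rw [this]
  exact norm_toLp_le_sum _

/-- Comparing the loss and the label with their values at the origin bounds the loss by four terms,
and the square of such a sum is at most four times the sum of squares. The powers `K ^ 4` come from
squaring the composed Lipschitz constant. -/
theorem sampleLoss_sq_le (n : ℕ) (Θ : Params (M.p n) k) (z) :
    M.sampleLoss n Θ z ^ 2 ≤ 4 * ((M.loss 0 0 + K * |M.label 0 0|) ^ 2
      + K ^ 2 * ∑ j, ⟪Θ j, z.1⟫ ^ 2 + K ^ 4 * ∑ j, ⟪M.truth n j, z.1⟫ ^ 2 + K ^ 4 * z.2 ^ 2) := by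
  have hu : ‖proj Θ z.1‖ ^ 2 = ∑ j, ⟪Θ j, z.1⟫ ^ 2 := norm_innerVec_sq (fun j => Θ j) z.1
  have hv : ‖proj (M.truth n) z.1‖ ^ 2 = ∑ j, ⟪M.truth n j, z.1⟫ ^ 2 :=
    norm_innerVec_sq (fun j => M.truth n j) z.1
  have h1 := hM.abs_loss_sub_le (proj Θ z.1) 0 (M.label (proj (M.truth n) z.1) z.2) 0
  have h2 := hM.abs_label_sub_le (proj (M.truth n) z.1) 0 z.2 0
  rw [sub_zero, sub_zero] at h1 h2
  have h3 : |M.label (proj (M.truth n) z.1) z.2|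
      ≤ |M.label 0 0| + K * (‖proj (M.truth n) z.1‖ + |z.2|) := by
    have := abs_sub_abs_le_abs_sub (M.label (proj (M.truth n) z.1) z.2) (M.label 0 0)
    linarith
  have h4 : M.sampleLoss n Θ z ≤ (M.loss 0 0 + K * |M.label 0 0|) + K * ‖proj Θ z.1‖
      + K ^ 2 * ‖proj (M.truth n) z.1‖ + K ^ 2 * |z.2| := by
    have h5 : M.sampleLoss n Θ z - M.loss 0 0 ≤ _ := (le_abs_self _).trans h1
    have h6 := mul_le_mul_of_nonneg_left h3 K.2
    simp only [NNReal.val_eq_coe] at h6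
    nlinarith
  rw [← hu, ← hv, ← sq_abs z.2]
  have h0 := hM.sampleLoss_nonneg n Θ z
  refine (pow_le_pow_left₀ h0 h4 2).trans ?_
  generalize (M.loss 0 0 + K * |M.label 0 0|) = a
  have e1 : (K : ℝ) ^ 2 * ‖proj Θ z.1‖ ^ 2 = (K * ‖proj Θ z.1‖) ^ 2 := by ring
  have e2 : (K : ℝ) ^ 4 * ‖proj (M.truth n) z.1‖ ^ 2
    = (K ^ 2 * ‖proj (M.truth n) z.1‖) ^ 2 := by ring
  have e3 : (K : ℝ) ^ 4 * |z.2| ^ 2 = (K ^ 2 * |z.2|) ^ 2 := by ring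
  rw [e1, e2, e3]
  generalize (K : ℝ) * ‖proj Θ z.1‖ = b
  generalize (K : ℝ) ^ 2 * ‖proj (M.truth n) z.1‖ = d
  generalize (K : ℝ) ^ 2 * |z.2| = e
  nlinarith [sq_nonneg (a - b), sq_nonneg (a - d), sq_nonneg (a - e), sq_nonneg (b - d),
    sq_nonneg (b - e), sq_nonneg (d - e)]

/-- A column of the true parameter shows that the set is nonempty; `0` is the midpoint of that
column and its negative. -/
theorem zero_mem (hkstar : 0 < kstar) (n : ℕ) : (0 : EuclideanSpace ℝ (Fin (M.p n))) ∈ M.S n := by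
  have h := hM.truth_mem n ⟨0, hkstar⟩
  have := hM.S_convex n h (hM.S_symm n _ h) (by norm_num : (0 : ℝ) ≤ 1 / 2)
    (by norm_num : (0 : ℝ) ≤ 1 / 2) (by norm_num)
  simpa using this

/-- Uniform bound on the second moment of the loss. -/
theorem exists_integral_sampleLoss_sq_le {c : ℝ} (hc : 0 < c)
    (hnoise : ∫⁻ e, ENNReal.ofReal (Real.exp (e ^ 2 / c ^ 2)) ∂M.noise ≤ 2) :
    ∃ C : ℝ, 0 ≤ C ∧ ∀ P, M.Admissible c P → ∀ n, ∀ Θ : Params (M.p n) k, (∀ j, Θ j ∈ M.S n) →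
      Integrable (fun z => M.sampleLoss n Θ z ^ 2) ((P n).prod M.noise) ∧
        ∫ z, M.sampleLoss n Θ z ^ 2 ∂((P n).prod M.noise) ≤ C := by
  refine ⟨4 * ((M.loss 0 0 + K * |M.label 0 0|) ^ 2
      + K ^ 2 * (k * c ^ 2) + K ^ 4 * (kstar * c ^ 2) + K ^ 4 * c ^ 2), by positivity,
      fun P hP n Θ hΘ => ?_⟩
  have := hP.prob n
  have := hM.noise_prob
  have hdir : ∀ θ ∈ M.S n, Integrable (fun z : EuclideanSpace ℝ (Fin (M.p n)) × ℝ => ⟪θ, z.1⟫ ^ 2)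
      ((P n).prod M.noise) ∧ ∫ z, ⟪θ, z.1⟫ ^ 2 ∂((P n).prod M.noise) ≤ c ^ 2 := by
    intro θ hθ
    have h := integrable_sq_of_lintegral_sq_le (f := fun x => ⟪θ, x⟫) (μ := P n)
      (Continuous.aestronglyMeasurable (by fun_prop)) (sq_nonneg c)
      (lintegral_sq_le_of_lintegral_exp_sq_le hc (hP.subgaussian n θ hθ))
    refine ⟨h.1.comp_fst _, ?_⟩
    rw [integral_fun_fst (fun x => ⟪θ, x⟫ ^ 2)]
    simpa using h.2
  have hno : Integrable (fun z : EuclideanSpace ℝ (Fin (M.p n)) × ℝ => z.2 ^ 2)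
      ((P n).prod M.noise) ∧ ∫ z, z.2 ^ 2 ∂((P n).prod M.noise) ≤ c ^ 2 := by
    have h := integrable_sq_of_lintegral_sq_le (f := fun e : ℝ => e) (μ := M.noise)
      (Continuous.aestronglyMeasurable (by fun_prop)) (sq_nonneg c)
      (lintegral_sq_le_of_lintegral_exp_sq_le hc hnoise)
    refine ⟨h.1.comp_snd _, ?_⟩
    rw [integral_fun_snd (fun e : ℝ => e ^ 2)]
    simpa using h.2
  have hsum : ∀ {l : ℕ} (T : Params (M.p n) l), (∀ j, T j ∈ M.S n) →
      Integrable (fun z : EuclideanSpace ℝ (Fin (M.p n)) × ℝ => ∑ j, ⟪T j, z.1⟫ ^ 2)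
        ((P n).prod M.noise) ∧ ∫ z, ∑ j, ⟪T j, z.1⟫ ^ 2 ∂((P n).prod M.noise) ≤ l * c ^ 2 := by
    intro l T hT
    refine ⟨integrable_finsetSum _ fun j _ => (hdir _ (hT j)).1, ?_⟩
    rw [integral_finsetSum _ fun j _ => (hdir _ (hT j)).1]
    calc _ ≤ ∑ _j : Fin l, c ^ 2 := Finset.sum_le_sum fun j _ => (hdir _ (hT j)).2
      _ = _ := by simp
  have h1 := hsum Θ hΘ
  have h2 := hsum (M.truth n) (hM.truth_mem n)
  have hi1 := (integrable_const (μ := (P n).prod M.noise)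
    ((M.loss 0 0 + K * |M.label 0 0|) ^ 2)).add (h1.1.const_mul ((K : ℝ) ^ 2))
  have hi2 := hi1.add (h2.1.const_mul ((K : ℝ) ^ 4))
  have hi := (hi2.add (hno.1.const_mul ((K : ℝ) ^ 4))).const_mul 4
  have hint : Integrable (fun z => M.sampleLoss n Θ z ^ 2) ((P n).prod M.noise) := by
    refine hi.mono' ((hM.continuous_sampleLoss n Θ).pow 2).aestronglyMeasurable
      (ae_of_all _ fun z => ?_)
    rw [Real.norm_of_nonneg (sq_nonneg _)]
    exact hM.sampleLoss_sq_le n Θ z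
  refine ⟨hint, (integral_mono hint hi fun z => hM.sampleLoss_sq_le n Θ z).trans ?_⟩
  rw [integral_const_mul, integral_add' hi2 (hno.1.const_mul _),
    integral_add' hi1 (h2.1.const_mul _),
    integral_add' (integrable_const _) (h1.1.const_mul _), integral_const_mul, integral_const_mul,
    integral_const_mul]
  simp only [integral_const, probReal_univ, smul_eq_mul, one_mul]
  have := h1.2
  have := h2.2
  have := hno.2
  gcongr

/-- Closeness of the expectations of bounded continuous functions of finitely many losses. -/
theorem close_of_sampleLoss (hkstar : 0 < kstar) {c : ℝ} (hc : 0 < c)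
    {P Q : ∀ n, Measure (EuclideanSpace ℝ (Fin (M.p n)))} (hP : M.Admissible c P)
    (hQ : M.Admissible c Q) (hPQ : CloseAlong M.S P Q) {m : ℕ} (g : (Fin m → ℝ) → ℝ)
    (hg : Continuous g) {B : ℝ} (hB : ∀ f, |g f| ≤ B) {ε : ℝ} (hε : 0 < ε) :
    ∀ᶠ n in atTop, ∀ Θ : Fin m → Params (M.p n) k, (∀ a j, Θ a j ∈ M.S n) →
      |∫ z, g (fun a => M.sampleLoss n (Θ a) z) ∂((P n).prod M.noise)
        - ∫ z, g (fun a => M.sampleLoss n (Θ a) z) ∂((Q n).prod M.noise)| ≤ ε := by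
  have := hP.prob
  have := hQ.prob
  have := hM.noise_prob
  let ι := (Fin m × Fin k) ⊕ Fin kstar
  let H : EuclideanSpace ℝ ι → ℝ → ℝ := fun u e => g fun a =>
    M.loss (WithLp.toLp 2 fun j => u (Sum.inl (a, j)))
      (M.label (WithLp.toLp 2 fun j => u (Sum.inr j)) e)
  have hH : Continuous (Function.uncurry H) := by
    refine hg.comp (continuous_pi fun a => ?_)
    refine hM.continuous_lossLabel.comp (Continuous.prodMk ?_ (Continuous.prodMk ?_ ?_)) <;> fun_prop
  have hHb : ∀ u e, |H u e| ≤ B := fun u e => hB _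
  -- Integrating out the noise leaves a bounded continuous function of `m * k + kstar` projections,
  -- a number independent of `n`.
  let φ : EuclideanSpace ℝ ι →ᵇ ℝ := BoundedContinuousFunction.ofNormedAddCommGroup
    (fun u => ∫ e, H u e ∂M.noise)
    (continuous_of_dominated (bound := fun _ => B)
      (fun u => (hH.comp (Continuous.prodMk_right u)).aestronglyMeasurable)
      (fun u => ae_of_all _ fun e => hHb u e) (integrable_const _)
      (ae_of_all _ fun e => hH.comp (Continuous.prodMk_left e))) B
    (fun u => by
      have := norm_integral_le_of_norm_le_const (μ := M.noise) (f := H u) (C := B)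
        (ae_of_all _ fun e => hHb u e)
      simpa using this)
  filter_upwards [hPQ.finite_dimensional hM.S_convex hM.S_symm (hM.zero_mem hkstar)
    (Real.toNNReal (c ^ 2))
    (fun n θ hθ => by
      have := hP.prob n
      exact lintegral_sq_le_of_lintegral_exp_sq_le hc (hP.subgaussian n θ hθ)) φ hε] with n hn Θ hΘ
  let θ : ι → EuclideanSpace ℝ (Fin (M.p n)) := Sum.elim (fun q => Θ q.1 q.2) (M.truth n)
  have hθ : ∀ i, θ i ∈ M.S n := by
    rintro (⟨a, j⟩ | j)
    · exact hΘ a j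
    · exact hM.truth_mem n j
  have key : ∀ (κ : Measure (EuclideanSpace ℝ (Fin (M.p n)))) [IsProbabilityMeasure κ],
      ∫ z, g (fun a => M.sampleLoss n (Θ a) z) ∂(κ.prod M.noise)
        = ∫ x, φ (innerVec θ x) ∂κ := by
    intro κ _
    rw [integral_prod]
    · rfl
    · refine Integrable.of_bound (C := B) (Continuous.aestronglyMeasurable ?_)
        (ae_of_all _ fun z => hB _)
      exact hg.comp (continuous_pi fun a => hM.continuous_sampleLoss n (Θ a))
  rw [key (P n), key (Q n)]
  exact hn θ hθ

end Assumptions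

end ERMUniversality.ERMSequence

/-- The truncated part satisfies `f - min f B ≤ f² / B` pointwise, so a second moment bound makes
truncation uniformly cheap. -/
theorem abs_integral_sub_integral_min_le {Ω : Type*} [MeasurableSpace Ω] {μ : Measure Ω}
    [IsProbabilityMeasure μ] {f : Ω → ℝ} (hf : AEStronglyMeasurable f μ)
    (hint : Integrable (fun ω => f ω ^ 2) μ) {C : ℝ} (hC : ∫ ω, f ω ^ 2 ∂μ ≤ C) {B : ℝ}
    (hB : 0 < B) : |∫ ω, f ω ∂μ - ∫ ω, min (f ω) B ∂μ| ≤ C / B := by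
  have hfi : Integrable f μ :=
    ((memLp_two_iff_integrable_sq hf).2 hint).integrable one_le_two
  have hmi : Integrable (fun ω => min (f ω) B) μ := hfi.inf (integrable_const B)
  rw [← integral_sub hfi hmi]
  have hle : ∀ ω, ‖f ω - min (f ω) B‖ ≤ f ω ^ 2 / B := by
    intro ω
    rw [Real.norm_of_nonneg (sub_nonneg.2 (min_le_left _ _)), le_div_iff₀ hB]
    rcases le_total (f ω) B with h | h
    · rw [min_eq_left h, sub_self, zero_mul]; positivity
    · rw [min_eq_right h]; nlinarith
  refine (norm_integral_le_of_norm_le (hint.div_const B) (ae_of_all _ hle)).trans ?_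
  rw [integral_div]
  gcongr

/-! ### Averages of Boltzmann factors and their logarithms -/

namespace ERMUniversality.ERMSequence

variable {k kstar : ℕ} {M : ERMSequence k kstar} {γ : ℝ} {R K : ℝ≥0} {Kr : ℝ≥0 → ℝ≥0}

variable (M) in
/-- The average `∑ w_i exp (-β F_i)` of the Boltzmann factors of finitely many parameters. -/
noncomputable def boltzmann (n : ℕ) (β : ℝ) {ι : Type} [Fintype ι] (w : ι → ℝ)
    (Θ : ι → Params (M.p n) k) (z : EuclideanSpace ℝ (Fin (M.p n)) × ℝ) : ℝ :=
  ∑ i, w i * Real.exp (-(β * M.sampleLoss n (Θ i) z))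

namespace Assumptions

variable (hM : M.Assumptions γ R K Kr)
include hM

section Boltzmann

variable {n : ℕ} {β : ℝ} {ι : Type} [Fintype ι] {w : ι → ℝ} (Θ : ι → Params (M.p n) k) (z : EuclideanSpace ℝ (Fin (M.p n)) × ℝ)

omit hM in
-- Jensen's inequality for the exponential. It keeps the logarithm under control however many
-- parameters are averaged.
theorem neg_sum_le_log_boltzmann (hw0 : ∀ i, 0 ≤ w i) (hw1 : ∑ i, w i = 1) :
    0 < M.boltzmann n β w Θ z ∧
      -Real.log (M.boltzmann n β w Θ z) ≤ β * ∑ i, w i * M.sampleLoss n (Θ i) z := by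
  have h := convexOn_exp.map_sum_le (t := Finset.univ) (w := w)
    (p := fun i => -(β * M.sampleLoss n (Θ i) z)) (fun i _ => hw0 i) hw1 (fun i _ => trivial)
  simp only [smul_eq_mul] at h
  have hpos : 0 < M.boltzmann n β w Θ z := (Real.exp_pos _).trans_le h
  refine ⟨hpos, ?_⟩
  have h2 := (Real.le_log_iff_exp_le hpos).2 h
  have e : ∑ i, w i * -(β * M.sampleLoss n (Θ i) z)
      = -(β * ∑ i, w i * M.sampleLoss n (Θ i) z) := by
    rw [Finset.mul_sum, ← Finset.sum_neg_distrib]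
    exact Finset.sum_congr rfl fun i _ => by ring
  linarith

theorem boltzmann_le_one (hw0 : ∀ i, 0 ≤ w i) (hw1 : ∑ i, w i = 1) (hβ : 0 ≤ β) :
    M.boltzmann n β w Θ z ≤ 1 := by
  rw [← hw1]
  refine Finset.sum_le_sum fun i _ => mul_le_of_le_one_right (hw0 i) ?_
  rw [Real.exp_le_one_iff]
  have := hM.sampleLoss_nonneg n (Θ i) z
  have := mul_nonneg hβ this
  linarith

theorem continuous_boltzmann : Continuous (M.boltzmann n β w Θ) :=
  continuous_finsetSum _ fun i _ => continuous_const.mul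
    (Real.continuous_exp.comp (continuous_const.mul (hM.continuous_sampleLoss n (Θ i))).neg)

/-- Here `0 ≤ -log ≤ β ∑ w L`; squaring and applying Jensen to the square gives a bound that does
not see the size of the family. -/
theorem log_boltzmann_sq_le (hw0 : ∀ i, 0 ≤ w i) (hw1 : ∑ i, w i = 1) (hβ : 0 ≤ β) :
    Real.log (M.boltzmann n β w Θ z) ^ 2 ≤ β ^ 2 * ∑ i, w i * M.sampleLoss n (Θ i) z ^ 2 := by
  have h1 := neg_sum_le_log_boltzmann (β := β) Θ z hw0 hw1
  have h2 := hM.boltzmann_le_one Θ z hw0 hw1 hβ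
  have h3 : Real.log (M.boltzmann n β w Θ z) ≤ 0 := Real.log_nonpos h1.1.le h2
  have h4 := (even_two.convexOn_pow (𝕜 := ℝ)).map_sum_le (t := Finset.univ) (w := w)
    (p := fun i => M.sampleLoss n (Θ i) z) (fun i _ => hw0 i) hw1 (fun i _ => trivial)
  simp only [smul_eq_mul] at h4
  calc Real.log (M.boltzmann n β w Θ z) ^ 2 = (-Real.log (M.boltzmann n β w Θ z)) ^ 2 := by ring
    _ ≤ (β * ∑ i, w i * M.sampleLoss n (Θ i) z) ^ 2 :=
        pow_le_pow_left₀ (by linarith) h1.2 2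
    _ = β ^ 2 * (∑ i, w i * M.sampleLoss n (Θ i) z) ^ 2 := by ring
    _ ≤ _ := mul_le_mul_of_nonneg_left h4 (sq_nonneg _)

theorem integral_log_boltzmann_sq_le (hw0 : ∀ i, 0 ≤ w i) (hw1 : ∑ i, w i = 1) (hβ : 0 ≤ β)
    {μ : Measure (EuclideanSpace ℝ (Fin (M.p n)) × ℝ)} {C : ℝ}
    (hC : ∀ i, Integrable (fun z => M.sampleLoss n (Θ i) z ^ 2) μ ∧
      ∫ z, M.sampleLoss n (Θ i) z ^ 2 ∂μ ≤ C) :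
    Integrable (fun z => Real.log (M.boltzmann n β w Θ z) ^ 2) μ ∧
      ∫ z, Real.log (M.boltzmann n β w Θ z) ^ 2 ∂μ ≤ β ^ 2 * C := by
  have hi : Integrable (fun z => β ^ 2 * ∑ i, w i * M.sampleLoss n (Θ i) z ^ 2) μ :=
    (integrable_finsetSum _ fun i _ => (hC i).1.const_mul _).const_mul _
  have hmeas : AEStronglyMeasurable (fun z => Real.log (M.boltzmann n β w Θ z) ^ 2) μ :=
    ((Real.measurable_log.comp (hM.continuous_boltzmann Θ).measurable).pow_const
      2).aestronglyMeasurable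
  have hint : Integrable (fun z => Real.log (M.boltzmann n β w Θ z) ^ 2) μ := by
    refine hi.mono' hmeas (ae_of_all _ fun z => ?_)
    rw [Real.norm_of_nonneg (sq_nonneg _)]
    exact hM.log_boltzmann_sq_le Θ z hw0 hw1 hβ
  refine ⟨hint, (integral_mono hint hi fun z =>
    hM.log_boltzmann_sq_le Θ z hw0 hw1 hβ).trans ?_⟩
  rw [integral_const_mul, integral_finsetSum _ fun i _ => (hC i).1.const_mul _]
  refine mul_le_mul_of_nonneg_left ?_ (sq_nonneg _)
  calc _ = ∑ i, w i * ∫ z, M.sampleLoss n (Θ i) z ^ 2 ∂μ := by simp_rw [integral_const_mul]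
    _ ≤ ∑ i, w i * C := Finset.sum_le_sum fun i _ => mul_le_mul_of_nonneg_left (hC i).2 (hw0 i)
    _ = C := by rw [← Finset.sum_mul, hw1, one_mul]

end Boltzmann

section Closeness

variable (hkstar : 0 < kstar) {c : ℝ} (hc : 0 < c)
  {P Q : ∀ n, Measure (EuclideanSpace ℝ (Fin (M.p n)))} (hP : M.Admissible c P)
  (hQ : M.Admissible c Q) (hPQ : CloseAlong M.S P Q)
include hkstar hc hP hQ hPQ

/-- Uniform closeness of the test errors. -/
theorem close_testError (hnoise : ∫⁻ e, ENNReal.ofReal (Real.exp (e ^ 2 / c ^ 2)) ∂M.noise ≤ 2)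
    {ε : ℝ} (hε : 0 < ε) :
    ∀ᶠ n in atTop, ∀ Θ : Params (M.p n) k, (∀ j, Θ j ∈ M.S n) →
      |M.testError n (P n) Θ - M.testError n (Q n) Θ| ≤ ε := by
  have := hP.prob
  have := hQ.prob
  have := hM.noise_prob
  obtain ⟨C, hC0, hC⟩ := hM.exists_integral_sampleLoss_sq_le hc hnoise
  set B := 3 * (C + 1) / ε with hB
  have hB0 : 0 < B := by positivity
  have hCB : C / B ≤ ε / 3 := by
    rw [hB, div_div_eq_mul_div, div_le_div_iff₀ (by positivity) (by norm_num)]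
    nlinarith
  -- The absolute value makes the test function bounded on the whole line; on the nonnegative losses
  -- it disappears. Truncation costs `ε / 3` under each law.
  filter_upwards [hM.close_of_sampleLoss hkstar hc hP hQ hPQ (m := 1) (fun f => min |f 0| B)
    (by fun_prop) (B := B) (fun f => by
      rw [abs_of_nonneg (le_min (abs_nonneg _) hB0.le)]; exact min_le_right _ _)
    (show (0 : ℝ) < ε / 3 by positivity)] with n hn Θ hΘ
  have h1 := hn (fun _ => Θ) fun _ => hΘ
  simp only [abs_of_nonneg (hM.sampleLoss_nonneg n Θ _)] at h1
  have htr : ∀ P', M.Admissible c P' → IsProbabilityMeasure (P' n) →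
      |∫ z, M.sampleLoss n Θ z ∂((P' n).prod M.noise)
        - ∫ z, min (M.sampleLoss n Θ z) B ∂((P' n).prod M.noise)| ≤ C / B := fun P' hP' _ =>
    abs_integral_sub_integral_min_le (hM.continuous_sampleLoss n Θ).aestronglyMeasurable
      (hC P' hP' n Θ hΘ).1 (hC P' hP' n Θ hΘ).2 hB0
  have h2 := htr P hP inferInstance
  have h3 := htr Q hQ inferInstance
  simp only [testError]
  rw [abs_le] at *
  constructor <;> linarith [h1.1, h1.2, h2.1, h2.2, h3.1, h3.2]

/-- Expanding the power over `m`-tuples of indices gives products of `m` Boltzmann factors with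
weights `∏ w (q a)`, whose sum is `(∑ w) ^ m = 1`. Each product is a bounded function of `m` losses,
so the error is independent of the size of the family. -/
theorem close_boltzmann_pow {β : ℝ} (hβ : 0 ≤ β) (m : ℕ) {ε : ℝ} (hε : 0 < ε) :
    ∀ᶠ n in atTop, ∀ (ι : Type) [Fintype ι] (w : ι → ℝ) (Θ : ι → Params (M.p n) k),
      (∀ i, 0 ≤ w i) → ∑ i, w i = 1 → (∀ i j, Θ i j ∈ M.S n) →
      |∫ z, M.boltzmann n β w Θ z ^ m ∂((P n).prod M.noise)
        - ∫ z, M.boltzmann n β w Θ z ^ m ∂((Q n).prod M.noise)| ≤ ε := by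
  have := hP.prob
  have := hQ.prob
  have := hM.noise_prob
  have hnn : ∀ x : ℝ, 0 ≤ β * |x| := fun x => mul_nonneg hβ (abs_nonneg x)
  filter_upwards [hM.close_of_sampleLoss hkstar hc hP hQ hPQ (m := m)
    (fun f => ∏ a, Real.exp (-(β * |f a|)))
    (by fun_prop) (B := 1) (fun f => by
      rw [abs_of_nonneg (Finset.prod_nonneg fun a _ => (Real.exp_pos _).le)]
      exact Finset.prod_le_one (fun a _ => (Real.exp_pos _).le) fun a _ =>
        Real.exp_le_one_iff.2 (neg_nonpos.2 (hnn _))) hε] with n hn ι _ w Θ hw0 hw1 hΘ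
  simp only [abs_of_nonneg (hM.sampleLoss_nonneg n _ _)] at hn
  have hcont : ∀ q : Fin m → ι, Continuous fun z =>
      ∏ a, Real.exp (-(β * M.sampleLoss n (Θ (q a)) z)) := fun q =>
    continuous_finsetProd _ fun a _ => Real.continuous_exp.comp
      (continuous_const.mul (hM.continuous_sampleLoss n _)).neg
  have hexp : ∀ (κ : Measure (EuclideanSpace ℝ (Fin (M.p n)))) [IsProbabilityMeasure κ],
      ∫ z, M.boltzmann n β w Θ z ^ m ∂(κ.prod M.noise) = ∑ q : Fin m → ι, (∏ a, w (q a)) *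
        ∫ z, ∏ a, Real.exp (-(β * M.sampleLoss n (Θ (q a)) z)) ∂(κ.prod M.noise) := by
    intro κ _
    simp_rw [boltzmann, Fintype.sum_pow, Finset.prod_mul_distrib]
    rw [integral_finsetSum]
    · simp_rw [integral_const_mul]
    · intro q _
      refine Integrable.const_mul (Integrable.of_bound (C := 1)
        (hcont q).aestronglyMeasurable (ae_of_all _ fun z => ?_)) _
      rw [Real.norm_of_nonneg (Finset.prod_nonneg fun a _ => (Real.exp_pos _).le)]
      exact Finset.prod_le_one (fun a _ => (Real.exp_pos _).le) fun a _ =>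
        Real.exp_le_one_iff.2 (neg_nonpos.2 (mul_nonneg hβ (hM.sampleLoss_nonneg n _ z)))
  rw [hexp (P n), hexp (Q n), ← Finset.sum_sub_distrib]
  refine (Finset.abs_sum_le_sum_abs _ _).trans ?_
  calc _ ≤ ∑ q : Fin m → ι, (∏ a, w (q a)) * ε := by
        refine Finset.sum_le_sum fun q _ => ?_
        have hq : 0 ≤ ∏ a, w (q a) := Finset.prod_nonneg fun a _ => hw0 _
        rw [← mul_sub, abs_mul, abs_of_nonneg hq]
        exact mul_le_mul_of_nonneg_left (hn (fun a => Θ (q a)) fun a => hΘ _) hq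
    _ = (∑ i, w i) ^ m * ε := by rw [Fintype.sum_pow, Finset.sum_mul]
    _ = ε := by rw [hw1, one_pow, one_mul]

open Polynomial in
theorem close_boltzmann_polynomial {β : ℝ} (hβ : 0 ≤ β) (q : ℝ[X]) :
    ∀ ε > 0, ∀ᶠ n in atTop, ∀ (ι : Type) [Fintype ι] (w : ι → ℝ) (Θ : ι → Params (M.p n) k),
      (∀ i, 0 ≤ w i) → ∑ i, w i = 1 → (∀ i j, Θ i j ∈ M.S n) →
      |∫ z, q.eval (M.boltzmann n β w Θ z) ∂((P n).prod M.noise)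
        - ∫ z, q.eval (M.boltzmann n β w Θ z) ∂((Q n).prod M.noise)| ≤ ε := by
  have := hP.prob
  have := hQ.prob
  have := hM.noise_prob
  have hint : ∀ (q : ℝ[X]) (n : ℕ) (ι : Type) [Fintype ι] (w : ι → ℝ)
      (Θ : ι → Params (M.p n) k), (∀ i, 0 ≤ w i) → ∑ i, w i = 1 →
      ∀ (κ : Measure (EuclideanSpace ℝ (Fin (M.p n)))) [IsProbabilityMeasure κ],
      Integrable (fun z => q.eval (M.boltzmann n β w Θ z)) (κ.prod M.noise) := by
    intro q n ι _ w Θ hw0 hw1 κ _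
    obtain ⟨B, hB⟩ := (isCompact_Icc (a := (0 : ℝ)) (b := 1)).exists_bound_of_continuousOn
      q.continuous.continuousOn
    exact Integrable.of_bound
      (q.continuous.comp (hM.continuous_boltzmann Θ)).aestronglyMeasurable B
      (ae_of_all _ fun z => hB _ ⟨(neg_sum_le_log_boltzmann (β := β) Θ z hw0 hw1).1.le,
        hM.boltzmann_le_one Θ z hw0 hw1 hβ⟩)
  induction q using Polynomial.induction_on' with
  | add q r hq hr =>
    intro ε hε
    filter_upwards [hq (ε / 2) (half_pos hε), hr (ε / 2) (half_pos hε)] with n h1 h2 ι _ w Θ hw0 hw1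
      hΘ
    have h1 := h1 ι w Θ hw0 hw1 hΘ
    have h2 := h2 ι w Θ hw0 hw1 hΘ
    simp_rw [eval_add]
    rw [integral_add (hint q n ι w Θ hw0 hw1 _) (hint r n ι w Θ hw0 hw1 _),
      integral_add (hint q n ι w Θ hw0 hw1 _) (hint r n ι w Θ hw0 hw1 _)]
    rw [abs_le] at *
    constructor <;> linarith [h1.1, h1.2, h2.1, h2.2]
  | monomial m a =>
    intro ε hε
    have hpos : 0 < |a| + 1 := by positivity
    filter_upwards [hM.close_boltzmann_pow hkstar hc hP hQ hPQ hβ m (div_pos hε hpos)]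
      with n h1 ι _ w Θ hw0 hw1 hΘ
    have h1 := h1 ι w Θ hw0 hw1 hΘ
    simp_rw [eval_monomial, integral_const_mul]
    rw [← mul_sub, abs_mul]
    rw [le_div_iff₀ hpos] at h1
    nlinarith [abs_nonneg (∫ z, M.boltzmann n β w Θ z ^ m ∂((P n).prod M.noise)
        - ∫ z, M.boltzmann n β w Θ z ^ m ∂((Q n).prod M.noise)), abs_nonneg a]

/-- Closeness of the expected log-averages of Boltzmann factors, uniformly over finite families of
parameters and weights. -/
theorem close_log_boltzmann
    (hnoise : ∫⁻ e, ENNReal.ofReal (Real.exp (e ^ 2 / c ^ 2)) ∂M.noise ≤ 2)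
    {β : ℝ} (hβ : 0 ≤ β) {ε : ℝ} (hε : 0 < ε) :
    ∀ᶠ n in atTop, ∀ (ι : Type) [Fintype ι] (w : ι → ℝ) (Θ : ι → Params (M.p n) k),
      (∀ i, 0 ≤ w i) → ∑ i, w i = 1 → (∀ i j, Θ i j ∈ M.S n) →
      |∫ z, -Real.log (M.boltzmann n β w Θ z) ∂((P n).prod M.noise)
        - ∫ z, -Real.log (M.boltzmann n β w Θ z) ∂((Q n).prod M.noise)| ≤ ε := by
  have := hP.prob
  have := hQ.prob
  have := hM.noise_prob
  obtain ⟨C, hC0, hC⟩ := hM.exists_integral_sampleLoss_sq_le hc hnoise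
  set B := 5 * (β ^ 2 * C + 1) / ε with hB
  have hB0 : 0 < B := by positivity
  have hCB : β ^ 2 * C / B ≤ ε / 5 := by
    have : 0 ≤ β ^ 2 * C := by positivity
    rw [hB, div_div_eq_mul_div, div_le_div_iff₀ (by positivity) (by norm_num)]
    nlinarith
  -- Truncating `-log` at level `B` means cutting its argument off at `exp (-B)`; the result is
  -- continuous on `[0, 1]`, so Weierstrass applies. Each law pays `ε / 5` for truncation and `ε /
  -- 5` for approximation, and the comparison of polynomials pays the last fifth.
  obtain ⟨q, hq⟩ := exists_polynomial_near_of_continuousOn 0 1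
    (fun y => -Real.log (max y (Real.exp (-B))))
    (Continuous.continuousOn (Continuous.neg (Continuous.log (by fun_prop)
      fun y => ((Real.exp_pos _).trans_le (le_max_right _ _)).ne'))) (ε / 5) (by positivity)
  filter_upwards [hM.close_boltzmann_polynomial hkstar hc hP hQ hPQ hβ q (ε / 5) (by positivity)]
    with n hn ι _ w Θ hw0 hw1 hΘ
  have hpos := fun z => (neg_sum_le_log_boltzmann (β := β) Θ z hw0 hw1).1
  have hle := fun z => hM.boltzmann_le_one Θ z hw0 hw1 hβ
  have hlog0 : ∀ z, 0 ≤ -Real.log (M.boltzmann n β w Θ z) := fun z =>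
    neg_nonneg.2 (Real.log_nonpos (hpos z).le (hle z))
  have hmeas : Measurable fun z => -Real.log (M.boltzmann n β w Θ z) :=
    (Real.measurable_log.comp (hM.continuous_boltzmann Θ).measurable).neg
  have htr : ∀ P', M.Admissible c P' → IsProbabilityMeasure (P' n) →
      |∫ z, -Real.log (M.boltzmann n β w Θ z) ∂((P' n).prod M.noise)
        - ∫ z, q.eval (M.boltzmann n β w Θ z) ∂((P' n).prod M.noise)| ≤ 2 * (ε / 5) := by
    intro P' hP' _
    have hsq := hM.integral_log_boltzmann_sq_le Θ hw0 hw1 hβ (fun i => hC P' hP' n (Θ i) (hΘ i))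
    have h1 := abs_integral_sub_integral_min_le (μ := (P' n).prod M.noise)
      hmeas.aestronglyMeasurable
      (by simpa only [neg_sq] using hsq.1) (by simpa only [neg_sq] using hsq.2) hB0
    have happ : ∀ z, ‖min (-Real.log (M.boltzmann n β w Θ z)) B
        - q.eval (M.boltzmann n β w Θ z)‖ ≤ ε / 5 := by
      intro z
      have h := hq _ ⟨(hpos z).le, hle z⟩
      have e : min (-Real.log (M.boltzmann n β w Θ z)) B
          = -Real.log (max (M.boltzmann n β w Θ z) (Real.exp (-B))) := by
        rcases le_total (M.boltzmann n β w Θ z) (Real.exp (-B)) with h' | h'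
        · have : Real.log (M.boltzmann n β w Θ z) ≤ -B := (Real.log_le_iff_le_exp (hpos z)).2 h'
          rw [max_eq_right h', Real.log_exp, min_eq_right (by linarith), neg_neg]
        · have : -B ≤ Real.log (M.boltzmann n β w Θ z) := (Real.le_log_iff_exp_le (hpos z)).2 h'
          rw [max_eq_left h', min_eq_left (by linarith)]
      rw [e, norm_sub_rev, Real.norm_eq_abs]
      exact h.le
    have hmi : Integrable (fun z => min (-Real.log (M.boltzmann n β w Θ z)) B)
        ((P' n).prod M.noise) := by
      refine Integrable.of_bound (C := B) (hmeas.min measurable_const).aestronglyMeasurable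
        (ae_of_all _ fun z => ?_)
      rw [Real.norm_of_nonneg (le_min (hlog0 z) hB0.le)]
      exact min_le_right _ _
    have hqi : Integrable (fun z => q.eval (M.boltzmann n β w Θ z)) ((P' n).prod M.noise) := by
      have hd : Integrable (fun z => min (-Real.log (M.boltzmann n β w Θ z)) B
          - q.eval (M.boltzmann n β w Θ z)) ((P' n).prod M.noise) :=
        Integrable.of_bound (((hmeas.min measurable_const).sub (q.continuous.comp
          (hM.continuous_boltzmann Θ)).measurable).aestronglyMeasurable) _ (ae_of_all _ happ)
      exact (hmi.sub hd).congr (ae_of_all _ fun z => by simp)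
    have h2 := norm_integral_le_of_norm_le_const (μ := (P' n).prod M.noise) (ae_of_all _ happ)
    rw [integral_sub hmi hqi, probReal_univ, mul_one, Real.norm_eq_abs] at h2
    rw [abs_le] at *
    constructor <;> linarith [h1.1, h1.2, h2.1, h2.2]
  have h1 := hn ι w Θ hw0 hw1 hΘ
  have h2 := htr P hP inferInstance
  have h3 := htr Q hQ inferInstance
  rw [abs_le] at *
  constructor <;> linarith [h1.1, h1.2, h2.1, h2.2, h3.1, h3.2]

end Closeness

end Assumptions

end ERMUniversality.ERMSequence

/-! ### Free energy and its universality -/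

namespace ERMUniversality.ERMSequence

variable {k kstar : ℕ} {M : ERMSequence k kstar} {γ : ℝ} {R K : ℝ≥0} {Kr : ℝ≥0 → ℝ≥0}

variable (M) in
/-- The free energy approximation of the minimum of the empirical risk over a finite family. -/
noncomputable def freeEnergy (n : ℕ) (β : ℝ) {ι : Type} [Fintype ι] (Θ : ι → Params (M.p n) k)
    (D : M.Data n) : ℝ :=
  -(1 / (n * β)) * Real.log (∑ i, Real.exp (-(n * β * M.empRisk n D (Θ i))))

section FreeEnergy

variable {n : ℕ} {β : ℝ} {ι : Type} [Fintype ι] (Θ : ι → Params (M.p n) k) (D : M.Data n)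

theorem freeEnergy_le (hn : 0 < n) (hβ : 0 < β) (i : ι) :
    M.freeEnergy n β Θ D ≤ M.empRisk n D (Θ i) := by
  have hn' : (0 : ℝ) < n * β := by positivity
  have h : Real.exp (-(n * β * M.empRisk n D (Θ i)))
      ≤ ∑ i, Real.exp (-(n * β * M.empRisk n D (Θ i))) :=
    Finset.single_le_sum (f := fun i => Real.exp (-(n * β * M.empRisk n D (Θ i))))
      (fun i _ => (Real.exp_pos _).le) (Finset.mem_univ i)
  have h2 := (Real.le_log_iff_exp_le ((Real.exp_pos _).trans_le h)).2 h
  rw [freeEnergy, neg_mul, neg_le, one_div, ← div_eq_inv_mul, le_div_iff₀ hn']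
  linarith

/-- At a minimizer, the partition function is at most the number of terms times the largest one.
With `freeEnergy_le` this makes the free energy a soft minimum; its error stays bounded for nets of
exponential size and is made small by a large `β`. -/
theorem exists_empRisk_le_freeEnergy_add [Nonempty ι] (hn : 0 < n) (hβ : 0 < β) :
    ∃ i, M.empRisk n D (Θ i)
      ≤ M.freeEnergy n β Θ D + Real.log (Fintype.card ι) / (n * β) := by
  have hn' : (0 : ℝ) < n * β := by positivity
  obtain ⟨i, hi⟩ := Finite.exists_min fun i => M.empRisk n D (Θ i)
  refine ⟨i, ?_⟩
  have hcard : (0 : ℝ) < Fintype.card ι := by exact_mod_cast Fintype.card_pos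
  have h : ∑ i, Real.exp (-(n * β * M.empRisk n D (Θ i)))
      ≤ Fintype.card ι * Real.exp (-(n * β * M.empRisk n D (Θ i))) := by
    refine (Finset.sum_le_card_nsmul _ _ (Real.exp (-(n * β * M.empRisk n D (Θ i))))
      fun j _ => Real.exp_le_exp.2 (neg_le_neg ?_)).trans_eq (by simp)
    exact mul_le_mul_of_nonneg_left (hi j) hn'.le
  have hpos : 0 < ∑ i, Real.exp (-(n * β * M.empRisk n D (Θ i))) :=
    Finset.sum_pos (fun _ _ => Real.exp_pos _) Finset.univ_nonempty
  have h2 := Real.log_le_log hpos h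
  rw [Real.log_mul hcard.ne' (Real.exp_pos _).ne', Real.log_exp] at h2
  rw [freeEnergy, neg_mul, one_div, ← div_eq_inv_mul, neg_add_eq_sub, ← sub_div, le_div_iff₀ hn']
  linarith

/-- Dependence of the free energy on a single sample. -/
theorem exists_freeEnergy_update_eq [Nonempty ι] (hn : 0 < n) (hβ : 0 < β) (j : Fin n) :
    ∃ (a : ℝ) (w : ι → ℝ), (∀ i, 0 ≤ w i) ∧ ∑ i, w i = 1 ∧ ∀ z,
      M.freeEnergy n β Θ (Function.update D j z)
        = a + (1 / (n * β)) * -Real.log (M.boltzmann n β w Θ z) := by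
  have hn' : (n : ℝ) ≠ 0 := by positivity
  -- These are the Gibbs weights with sample `j` left out. As `n` times the risk is additive over
  -- samples, the partition function is their sum times a Boltzmann average at `z`.
  set e : ι → ℝ := fun i => Real.exp (-(β * (∑ l ∈ Finset.univ.erase j, M.sampleLoss n (Θ i) (D l)
    + n * M.reg n (Θ i)))) with he
  have hA : 0 < ∑ i, e i := Finset.sum_pos (fun _ _ => Real.exp_pos _) Finset.univ_nonempty
  refine ⟨-(1 / (n * β)) * Real.log (∑ i, e i), fun i => e i / ∑ i, e i,
    fun i => div_nonneg (Real.exp_pos _).le hA.le, by rw [← Finset.sum_div, div_self hA.ne'],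
    fun z => ?_⟩
  have hsum : ∑ i, Real.exp (-(n * β * M.empRisk n (Function.update D j z) (Θ i)))
      = (∑ i, e i) * M.boltzmann n β (fun i => e i / ∑ i, e i) Θ z := by
    rw [boltzmann, Finset.mul_sum]
    refine Finset.sum_congr rfl fun i _ => ?_
    rw [← mul_assoc, mul_div_cancel₀ _ hA.ne', he, ← Real.exp_add]
    congr 1
    have h1 : ∑ l, M.sampleLoss n (Θ i) (Function.update D j z l)
        = M.sampleLoss n (Θ i) z + ∑ l ∈ Finset.univ.erase j, M.sampleLoss n (Θ i) (D l) := by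
      rw [← Finset.add_sum_erase _ _ (Finset.mem_univ j), Function.update_self]
      congr 1
      refine Finset.sum_congr rfl fun l hl => ?_
      rw [Function.update_of_ne (Finset.ne_of_mem_erase hl)]
    rw [empRisk, h1]
    field_simp
    ring
  have hY : 0 < M.boltzmann n β (fun i => e i / ∑ i, e i) Θ z := by
    have : 0 < ∑ i, Real.exp (-(n * β * M.empRisk n (Function.update D j z) (Θ i))) :=
      Finset.sum_pos (fun _ _ => Real.exp_pos _) Finset.univ_nonempty
    rw [hsum] at this
    exact pos_of_mul_pos_right this hA.le
  rw [freeEnergy, hsum, Real.log_mul hA.ne' hY.ne']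
  ring

end FreeEnergy

namespace Assumptions

variable (hM : M.Assumptions γ R K Kr)
include hM

theorem continuous_empRisk (n : ℕ) (Θ : Params (M.p n) k) :
    Continuous fun D : M.Data n => M.empRisk n D Θ :=
  (continuous_const.mul (continuous_finsetSum _ fun i _ =>
    (hM.continuous_sampleLoss n Θ).comp (continuous_apply i))).add continuous_const

theorem measurable_freeEnergy (n : ℕ) (β : ℝ) {ι : Type} [Fintype ι] (Θ : ι → Params (M.p n) k) :
    Measurable (M.freeEnergy n β Θ) :=
  (Real.measurable_log.comp (continuous_finsetSum _ fun i _ => Real.continuous_exp.comp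
    (continuous_const.mul (hM.continuous_empRisk n (Θ i))).neg).measurable).const_mul _

/-- Asymptotic universality of smooth statistics of the free energy, uniformly over finite families
of parameters. -/
theorem close_freeEnergy (hkstar : 0 < kstar) {c : ℝ} (hc : 0 < c)
    {P Q : ∀ n, Measure (EuclideanSpace ℝ (Fin (M.p n)))} (hP : M.Admissible c P)
    (hQ : M.Admissible c Q) (hPQ : CloseAlong M.S P Q)
    (hnoise : ∫⁻ e, ENNReal.ofReal (Real.exp (e ^ 2 / c ^ 2)) ∂M.noise ≤ 2)
    {β : ℝ} (hβ : 0 < β) {ψ ψ' : ℝ → ℝ} {C : ℝ} (hC : 0 ≤ C) (hψ : Continuous ψ)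
    (hψ01 : ∀ x, 0 ≤ ψ x ∧ ψ x ≤ 1) (hψ' : ∀ x, |ψ' x| ≤ C)
    (hψ'' : ∀ x h, |ψ (x + h) - ψ x - ψ' x * h| ≤ C * h ^ 2) {ε : ℝ} (hε : 0 < ε) :
    ∀ᶠ n in atTop, ∀ (ι : Type) [Fintype ι] [Nonempty ι] (Θ : ι → Params (M.p n) k),
      (∀ i j, Θ i j ∈ M.S n) →
      |∫ D, ψ (M.freeEnergy n β Θ D) ∂(M.sampleLaw n (P n))
        - ∫ D, ψ (M.freeEnergy n β Θ D) ∂(M.sampleLaw n (Q n))| ≤ ε := by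
  have := hP.prob
  have := hQ.prob
  have := hM.noise_prob
  obtain ⟨C₂, hC₂0, hC₂⟩ := hM.exists_integral_sampleLoss_sq_le hc hnoise
  -- Chosen so that the first-order terms, with factors `|ψ' a| ≤ C` and `s = 1 / (n * β)`, differ
  -- by at most `ε / (2 * n)`. The lower bound on `n` below makes the two quadratic remainders total
  -- at most the same amount.
  have hη : 0 < ε * β / (2 * (C + 1)) := by positivity
  filter_upwards [hM.close_log_boltzmann hkstar hc hP hQ hPQ hnoise hβ.le hη, eventually_gt_atTop 0,
    (tendsto_natCast_atTop_atTop (R := ℝ)).eventually_ge_atTop (4 * C * C₂ / ε)]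
    with n hlog hn hnbig ι _ _ Θ hΘ
  have hn0 : (0 : ℝ) < n := by exact_mod_cast hn
  have hψm : Measurable fun D => ψ (M.freeEnergy n β Θ D) :=
    hψ.measurable.comp (hM.measurable_freeEnergy n β Θ)
  have hψabs : ∀ x, |ψ x| ≤ 1 := fun x => by
    rw [abs_of_nonneg (hψ01 x).1]; exact (hψ01 x).2
  have main := abs_integral_pi_sub_integral_pi_le ((P n).prod M.noise) ((Q n).prod M.noise)
    (δ := ε / n) (B := 1) n (fun D => ψ (M.freeEnergy n β Θ D)) hψm (fun D => hψabs _) ?_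
  · rwa [mul_div_cancel₀ _ hn0.ne'] at main
  intro D j
  obtain ⟨a, w, hw0, hw1, hf⟩ := exists_freeEnergy_update_eq Θ D hn hβ j
  simp_rw [hf]
  set h : EuclideanSpace ℝ (Fin (M.p n)) × ℝ → ℝ := fun z => -Real.log (M.boltzmann n β w Θ z)
    with hh
  have hmeas : Measurable h :=
    (Real.measurable_log.comp (hM.continuous_boltzmann Θ).measurable).neg
  set s : ℝ := 1 / (n * β) with hs
  have hs0 : 0 < s := by positivity
  -- First-order expansion around `a`, the part of the free energy free of sample `j`. The remainder
  -- is `C * s ^ 2` times a second moment of size `β ^ 2 * C₂`, and `β` cancels.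
  have herr : ∀ P', M.Admissible c P' → IsProbabilityMeasure (P' n) →
      |∫ z, ψ (a + s * h z) ∂((P' n).prod M.noise)
        - (ψ a + ψ' a * (s * ∫ z, h z ∂((P' n).prod M.noise)))| ≤ C * C₂ / n ^ 2 := by
    intro P' hP' _
    have hsq := hM.integral_log_boltzmann_sq_le Θ hw0 hw1 hβ.le
      (fun i => hC₂ P' hP' n (Θ i) (hΘ i))
    have hsqi : Integrable (fun z => h z ^ 2) ((P' n).prod M.noise) := by
      simpa only [hh, neg_sq] using hsq.1
    have hsqle : ∫ z, h z ^ 2 ∂((P' n).prod M.noise) ≤ β ^ 2 * C₂ := by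
      simpa only [hh, neg_sq] using hsq.2
    have hi : Integrable h ((P' n).prod M.noise) :=
      ((memLp_two_iff_integrable_sq hmeas.aestronglyMeasurable).2 hsqi).integrable one_le_two
    have hψi : Integrable (fun z => ψ (a + s * h z)) ((P' n).prod M.noise) :=
      Integrable.of_bound (hψ.measurable.comp
        ((hmeas.const_mul s).const_add a)).aestronglyMeasurable 1 (ae_of_all _ fun z => hψabs _)
    have hlin : Integrable (fun z => ψ a + ψ' a * (s * h z)) ((P' n).prod M.noise) :=
      (integrable_const _).add ((hi.const_mul s).const_mul _)
    have e1 : ∫ z, (ψ a + ψ' a * (s * h z)) ∂((P' n).prod M.noise)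
        = ψ a + ψ' a * (s * ∫ z, h z ∂((P' n).prod M.noise)) := by
      rw [integral_add (integrable_const _) ((hi.const_mul s).const_mul _), integral_const_mul,
        integral_const_mul]
      simp
    rw [← e1, ← integral_sub hψi hlin]
    have hb : ∀ z, ‖ψ (a + s * h z) - (ψ a + ψ' a * (s * h z))‖ ≤ C * s ^ 2 * h z ^ 2 := by
      intro z
      rw [Real.norm_eq_abs, ← sub_sub, mul_assoc, ← mul_pow]
      exact hψ'' a (s * h z)
    refine (norm_integral_le_of_norm_le (hsqi.const_mul (C * s ^ 2)) (ae_of_all _ hb)).trans ?_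
    rw [integral_const_mul]
    calc _ ≤ C * s ^ 2 * (β ^ 2 * C₂) := mul_le_mul_of_nonneg_left hsqle (by positivity)
      _ = C * C₂ / n ^ 2 := by rw [hs]; field_simp
  have h1 := herr P hP inferInstance
  have h2 := herr Q hQ inferInstance
  have h3 := hlog ι w Θ hw0 hw1 hΘ
  change |∫ z, h z ∂((P n).prod M.noise) - ∫ z, h z ∂((Q n).prod M.noise)| ≤ _ at h3
  generalize (∫ z, h z ∂((P n).prod M.noise)) = x at *
  generalize (∫ z, h z ∂((Q n).prod M.noise)) = y at *
  have h4 : |ψ' a * (s * x) - ψ' a * (s * y)| ≤ ε / (2 * n) := by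
    have : ψ' a * (s * x) - ψ' a * (s * y) = ψ' a * (s * (x - y)) := by ring
    rw [this, abs_mul, abs_mul, abs_of_pos hs0]
    calc |ψ' a| * (s * |x - y|) ≤ (C + 1) * (s * (ε * β / (2 * (C + 1)))) := by
          gcongr
          linarith [hψ' a]
      _ = ε / (2 * n) := by rw [hs]; field_simp
  have h5 : 2 * (C * C₂ / n ^ 2) ≤ ε / (2 * n) := by
    rw [div_le_iff₀ hε] at hnbig
    rw [mul_div_assoc', div_le_div_iff₀ (by positivity) (by positivity)]
    nlinarith
  have h6 : ε / (2 * n) + ε / (2 * n) = ε / n := by field_simp; ring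
  rw [← h6]
  rw [abs_le] at *
  constructor <;> linarith [h1.1, h1.2, h2.1, h2.2, h4.1, h4.2]

end Assumptions

end ERMUniversality.ERMSequence

/-! ### Uniform control of the projections, and passage from nets to arbitrary sets -/

/-- Chernoff's bound for sums of independent copies. -/
theorem measureReal_pi_le_sum_le {Z : Type*} [MeasurableSpace Z] (μ : Measure Z)
    [IsProbabilityMeasure μ] {f : Z → ℝ} {A : ℝ}
    (hint : Integrable (fun z => Real.exp (f z)) μ) (hA : ∫ z, Real.exp (f z) ∂μ ≤ A)
    (n : ℕ) (s : ℝ) :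
    (Measure.pi fun _ : Fin n => μ).real {D | s ≤ ∑ i, f (D i)} ≤ Real.exp (-s) * A ^ n := by
  have h := mul_meas_ge_le_integral_of_nonneg (μ := Measure.pi fun _ : Fin n => μ)
    (f := fun D => ∏ i, Real.exp (f (D i)))
    (ae_of_all _ fun D => Finset.prod_nonneg fun i _ => (Real.exp_pos _).le)
    (Integrable.fintype_prod (f := fun _ z => Real.exp (f z)) fun _ => hint) (Real.exp s)
  rw [integral_fintype_prod_eq_prod (fun _ z => Real.exp (f z))] at h
  simp only [← Real.exp_sum, Real.exp_le_exp, Finset.prod_const, Finset.card_univ,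
    Fintype.card_fin] at h
  have hA0 : 0 ≤ ∫ z, Real.exp (f z) ∂μ := integral_nonneg fun z => (Real.exp_pos _).le
  rw [Real.exp_neg, ← div_eq_inv_mul, le_div_iff₀' (Real.exp_pos _)]
  exact h.trans (pow_le_pow_left₀ hA0 hA n)

/-- Fatou's lemma along an approximating sequence. The sets of directions need not be closed,
whereas the covering argument needs compactness. -/
theorem lintegral_exp_sq_inner_le_of_mem_closure {E : Type*} [NormedAddCommGroup E]
    [InnerProductSpace ℝ E] [MeasurableSpace E] [BorelSpace E] {μ : Measure E} {S : Set E} {c : ℝ}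
    (h : ∀ θ ∈ S, ∫⁻ x, ENNReal.ofReal (Real.exp (⟪θ, x⟫ ^ 2 / c ^ 2)) ∂μ ≤ 2) {θ : E}
    (hθ : θ ∈ closure S) :
    ∫⁻ x, ENNReal.ofReal (Real.exp (⟪θ, x⟫ ^ 2 / c ^ 2)) ∂μ ≤ 2 := by
  obtain ⟨u, hu, hlim⟩ := mem_closure_iff_seq_limit.1 hθ
  have hconv : ∀ x, Tendsto (fun m => ENNReal.ofReal (Real.exp (⟪u m, x⟫ ^ 2 / c ^ 2))) atTop
      (𝓝 (ENNReal.ofReal (Real.exp (⟪θ, x⟫ ^ 2 / c ^ 2)))) := fun x =>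
    ENNReal.tendsto_ofReal ((Real.continuous_exp.tendsto _).comp
      (((hlim.inner tendsto_const_nhds).pow 2).div_const _))
  calc _ = ∫⁻ x, liminf (fun m => ENNReal.ofReal (Real.exp (⟪u m, x⟫ ^ 2 / c ^ 2))) atTop ∂μ := by
        congr 1 with x
        exact (hconv x).liminf_eq.symm
    _ ≤ liminf (fun m => ∫⁻ x, ENNReal.ofReal (Real.exp (⟪u m, x⟫ ^ 2 / c ^ 2)) ∂μ) atTop :=
        lintegral_liminf_le fun m => Measurable.ennreal_ofReal
          (Continuous.measurable (by fun_prop))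
    _ ≤ 2 := by
        refine (liminf_le_liminf (Eventually.of_forall fun m => h _ (hu m))).trans ?_
        simp

/-- Use `y ≤ 1 + y²` in the exponent, then `2 ≤ e`. -/
theorem integral_exp_abs_le {Ω : Type*} [MeasurableSpace Ω] {μ : Measure Ω} {f : Ω → ℝ} {c : ℝ}
    (hf : Measurable f)
    (h : ∫⁻ ω, ENNReal.ofReal (Real.exp (f ω ^ 2 / c ^ 2)) ∂μ ≤ 2) :
    Integrable (fun ω => Real.exp (|f ω| / c)) μ ∧
      ∫ ω, Real.exp (|f ω| / c) ∂μ ≤ Real.exp 2 := by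
  have hm : Measurable fun ω => Real.exp (|f ω| / c) :=
    Real.measurable_exp.comp ((continuous_abs.measurable.comp hf).div_const c)
  have hle : ∫⁻ ω, ENNReal.ofReal (Real.exp (|f ω| / c)) ∂μ ≤ ENNReal.ofReal (Real.exp 2) := by
    calc _ ≤ ∫⁻ ω, ENNReal.ofReal (Real.exp 1) *
          ENNReal.ofReal (Real.exp (f ω ^ 2 / c ^ 2)) ∂μ := by
          refine lintegral_mono fun ω => ?_
          rw [← ENNReal.ofReal_mul (Real.exp_pos _).le, ← Real.exp_add]
          refine ENNReal.ofReal_le_ofReal (Real.exp_le_exp.2 ?_)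
          have : f ω ^ 2 / c ^ 2 = (|f ω| / c) ^ 2 := by rw [div_pow, sq_abs]
          rw [this]
          nlinarith [sq_nonneg (|f ω| / c - 1), sq_nonneg (|f ω| / c)]
      _ = ENNReal.ofReal (Real.exp 1) * ∫⁻ ω, ENNReal.ofReal (Real.exp (f ω ^ 2 / c ^ 2)) ∂μ :=
          lintegral_const_mul' _ _ ENNReal.ofReal_ne_top
      _ ≤ ENNReal.ofReal (Real.exp 1) * ENNReal.ofReal 2 := by gcongr; simpa using h
      _ ≤ ENNReal.ofReal (Real.exp 2) := by
          rw [← ENNReal.ofReal_mul (Real.exp_pos _).le]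
          refine ENNReal.ofReal_le_ofReal ?_
          have e : Real.exp 2 = Real.exp 1 * Real.exp 1 := by rw [← Real.exp_add]; norm_num
          rw [e]
          exact mul_le_mul_of_nonneg_left (by linarith [Real.add_one_le_exp 1])
            (Real.exp_pos _).le
  have hnn : 0 ≤ᵐ[μ] fun ω => Real.exp (|f ω| / c) := ae_of_all _ fun ω => (Real.exp_pos _).le
  refine ⟨⟨hm.aestronglyMeasurable, ?_⟩, ?_⟩
  · rw [hasFiniteIntegral_iff_ofReal hnn]
    exact hle.trans_lt ENNReal.ofReal_lt_top
  · rw [integral_eq_lintegral_of_nonneg_ae hnn hm.aestronglyMeasurable]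
    exact ENNReal.toReal_le_of_le_ofReal (Real.exp_pos _).le hle

namespace ERMUniversality.ERMSequence

variable {k kstar : ℕ} {M : ERMSequence k kstar} {γ : ℝ} {R K : ℝ≥0} {Kr : ℝ≥0 → ℝ≥0}

variable (M) in
/-- The average over the data of the absolute projections along a direction. -/
noncomputable def avgProj (n : ℕ) (θ : EuclideanSpace ℝ (Fin (M.p n))) (D : M.Data n) : ℝ :=
  (1 / (n : ℝ)) * ∑ i, |⟪θ, (D i).1⟫|

section AvgProj

variable {n : ℕ} (θ θ' : EuclideanSpace ℝ (Fin (M.p n))) (D : M.Data n)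

theorem avgProj_add_le : M.avgProj n (θ + θ') D ≤ M.avgProj n θ D + M.avgProj n θ' D := by
  rw [avgProj, avgProj, avgProj, ← mul_add, ← Finset.sum_add_distrib]
  refine mul_le_mul_of_nonneg_left (Finset.sum_le_sum fun i _ => ?_) (by positivity)
  rw [inner_add_left]
  exact abs_add_le _ _

theorem avgProj_smul (a : ℝ) : M.avgProj n (a • θ) D = |a| * M.avgProj n θ D := by
  simp only [avgProj, real_inner_smul_left, abs_mul, ← Finset.mul_sum]
  ring

theorem continuous_avgProj : Continuous fun θ => M.avgProj n θ D := by
  unfold avgProj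
  fun_prop

end AvgProj

namespace Assumptions

variable (hM : M.Assumptions γ R K Kr)
include hM

theorem isCompact_closure_S (n : ℕ) : IsCompact (closure (M.S n)) :=
  (Metric.isBounded_closedBall.subset (hM.S_subset n)).isCompact_closure

theorem neg_mem_closure_S (n : ℕ) (θ) (hθ : θ ∈ closure (M.S n)) : -θ ∈ closure (M.S n) := by
  have := Set.mem_image_of_mem (fun θ => -θ) hθ
  exact closure_mono (Set.image_subset_iff.2 fun x hx => hM.S_symm n x hx)
    (image_closure_subset_closure_image continuous_neg this)

theorem norm_le_of_mem_closure_S (n : ℕ) (θ) (hθ : θ ∈ closure (M.S n)) : ‖θ‖ ≤ R := by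
  have := closure_minimal (hM.S_subset n) Metric.isClosed_closedBall hθ
  simpa using this

theorem eventually_dim_le : ∀ᶠ n in atTop, (M.p n : ℝ) ≤ (γ + 1) * n := by
  filter_upwards [hM.tendsto_ratio.eventually (eventually_lt_nhds (lt_add_one γ)),
    eventually_gt_atTop 0] with n hn hn0
  have : (0 : ℝ) < n := by exact_mod_cast hn0
  rw [div_lt_iff₀ this] at hn
  exact hn.le

theorem ratio_nonneg : 0 ≤ γ :=
  ge_of_tendsto' hM.tendsto_ratio fun n => by positivity

/-- The averages of the absolute projections are bounded with high probability, uniformly over the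
directions. -/
theorem exists_avgProj_le {c : ℝ} (hc : 0 < c)
    {P : ∀ n, Measure (EuclideanSpace ℝ (Fin (M.p n)))} (hP : M.Admissible c P) :
    ∃ C : ℝ, 0 < C ∧ ∀ δ > 0, ∀ᶠ n in atTop,
      (M.sampleLaw n (P n)).real {D | ∃ θ ∈ closure (M.S n), C < M.avgProj n θ D} ≤ δ := by
  have := hP.prob
  have := hM.noise_prob
  have hγ := hM.ratio_nonneg
  -- Per sample, the exponent must beat `2 * (γ + 1)` for the net of at most `5 ^ p ≤ exp (2 * p)`
  -- points and `2` for the exponential moment; the remaining `1` gives the decay `exp (-n)`.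
  set C₁ := c * (2 * (γ + 1) + 3) with hC₁
  have hC₁0 : 0 < C₁ := by positivity
  refine ⟨2 * C₁, by positivity, fun δ hδ => ?_⟩
  have hlim : Tendsto (fun n : ℕ => Real.exp (-(n : ℝ))) atTop (𝓝 0) :=
    Real.tendsto_exp_neg_atTop_nhds_zero.comp tendsto_natCast_atTop_atTop
  filter_upwards [hlim.eventually (eventually_lt_nhds hδ), hM.eventually_dim_le,
    eventually_gt_atTop 0] with n hnδ hdim hn
  have hn0 : (0 : ℝ) < n := by exact_mod_cast hn
  have hcomp := hM.isCompact_closure_S n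
  obtain ⟨N, hNmem, hNnet, hNcard⟩ := exists_gauge_net (hM.S_convex n).closure
    (hM.neg_mem_closure_S n) hcomp (ε := 1 / 2) (by norm_num) (A := closure (M.S n)) subset_rfl
  have hsub : {D | ∃ θ ∈ closure (M.S n), 2 * C₁ < M.avgProj n θ D}
      ⊆ ⋃ s ∈ N, {D : M.Data n | n * (2 * (γ + 1) + 3) ≤ ∑ i, |⟪s, (D i).1⟫| / c} := by
    rintro D ⟨θ, hθ, hlt⟩
    by_contra hcon
    simp only [Set.mem_iUnion, Set.mem_ofPred_eq, not_exists, not_le] at hcon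
    have hs : ∀ s ∈ N, M.avgProj n s D ≤ C₁ := by
      intro s hs
      have h := hcon s hs
      rw [← Finset.sum_div, div_lt_iff₀ hc] at h
      rw [avgProj, one_div, ← div_eq_inv_mul, div_le_iff₀ hn0]
      calc _ ≤ _ := h.le
        _ = _ := by rw [hC₁]; ring
    -- At a maximizer, splitting off a net point leaves half an element of the same set, so the
    -- maximum `m` satisfies `m ≤ C₁ + m / 2`.
    obtain ⟨θ₀, hθ₀, hmax⟩ := hcomp.exists_isMaxOn ⟨θ, hθ⟩ (continuous_avgProj D).continuousOn
    obtain ⟨s, hsN, τ, hτ, hτe⟩ := hNnet θ₀ hθ₀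
    have h1 : M.avgProj n θ₀ D ≤ M.avgProj n s D + (1 / 2) * M.avgProj n τ D := by
      have hτe' : (1 / 2 : ℝ) • τ = θ₀ - s := hτe
      have e : θ₀ = s + (1 / 2 : ℝ) • τ := by rw [hτe']; abel
      calc M.avgProj n θ₀ D = M.avgProj n (s + (1 / 2 : ℝ) • τ) D := by rw [← e]
        _ ≤ _ := avgProj_add_le _ _ _
        _ = _ := by rw [avgProj_smul, abs_of_pos (by norm_num : (0 : ℝ) < 1 / 2)]
    have h2 := hs s hsN
    have h3 : M.avgProj n τ D ≤ M.avgProj n θ₀ D := hmax hτ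
    have h4 : M.avgProj n θ D ≤ M.avgProj n θ₀ D := hmax hθ
    linarith
  have hone : ∀ s ∈ N, (M.sampleLaw n (P n)).real
      {D : M.Data n | n * (2 * (γ + 1) + 3) ≤ ∑ i, |⟪s, (D i).1⟫| / c}
      ≤ Real.exp (-(n * (2 * (γ + 1) + 3))) * Real.exp 2 ^ n := by
    intro s hs
    have h := integral_exp_abs_le (f := fun x => ⟪s, x⟫) (μ := P n)
      (Continuous.measurable (by fun_prop))
      (lintegral_exp_sq_inner_le_of_mem_closure (hP.subgaussian n) (hNmem s hs))
    refine measureReal_pi_le_sum_le ((P n).prod M.noise)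
      (f := fun z => |⟪s, z.1⟫| / c) (h.1.comp_fst _) ?_ n _
    rw [integral_fun_fst (fun x => Real.exp (|⟪s, x⟫| / c))]
    simpa using h.2
  have hcard : (N.card : ℝ) ≤ Real.exp (2 * ((γ + 1) * n)) := by
    refine hNcard.trans ?_
    rw [finrank_euclideanSpace_fin]
    calc (1 + 2 / (1 / 2 : ℝ)) ^ M.p n ≤ Real.exp 2 ^ M.p n := by
          refine pow_le_pow_left₀ (by norm_num) ?_ _
          have e : Real.exp 2 = Real.exp 1 * Real.exp 1 := by rw [← Real.exp_add]; norm_num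
          rw [e]
          nlinarith [Real.exp_one_gt_d9]
      _ = Real.exp (M.p n * 2) := by rw [Real.exp_nat_mul]
      _ ≤ _ := Real.exp_le_exp.2 (by linarith)
  have hfin : IsProbabilityMeasure (M.sampleLaw n (P n)) := by
    unfold sampleLaw; infer_instance
  calc _ ≤ _ := measureReal_mono hsub (measure_ne_top _ _)
    _ ≤ ∑ s ∈ N, (M.sampleLaw n (P n)).real
      {D : M.Data n | n * (2 * (γ + 1) + 3) ≤ ∑ i, |⟪s, (D i).1⟫| / c} :=
        measureReal_biUnion_finset_le _ _
    _ ≤ ∑ _s ∈ N, Real.exp (-(n * (2 * (γ + 1) + 3))) * Real.exp 2 ^ n := Finset.sum_le_sum hone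
    _ = N.card * (Real.exp (-(n * (2 * (γ + 1) + 3))) * Real.exp 2 ^ n) := by
        rw [Finset.sum_const, nsmul_eq_mul]
    _ ≤ Real.exp (2 * ((γ + 1) * n)) * (Real.exp (-(n * (2 * (γ + 1) + 3))) * Real.exp 2 ^ n) :=
        mul_le_mul_of_nonneg_right hcard (by positivity)
    _ = Real.exp (-n) := by
        rw [← Real.exp_nat_mul, ← Real.exp_add, ← Real.exp_add]
        congr 1
        ring
    _ ≤ δ := hnδ.le

omit hM in
theorem norm_params_le {p l : ℕ} {Θ : Params p l} {r : ℝ} (h : ∀ j, ‖Θ j‖ ≤ r) :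
    ‖Θ‖ ≤ l * r := by
  have h1 : ‖Θ‖ ≤ ∑ j, ‖Θ j‖ := by
    rw [PiLp.norm_eq_of_L2]
    exact Real.sqrt_le_iff.2 ⟨Finset.sum_nonneg fun j _ => norm_nonneg _,
      Finset.sum_sq_le_sq_sum_of_nonneg fun j _ => norm_nonneg _⟩
  calc _ ≤ _ := h1
    _ ≤ ∑ _j : Fin l, r := Finset.sum_le_sum fun j _ => h j
    _ = l * r := by simp

omit hM in
theorem finrank_params (p l : ℕ) : Module.finrank ℝ (Params p l) = l * p := by
  rw [(WithLp.linearEquiv 2 ℝ (Fin l → EuclideanSpace ℝ (Fin p))).finrank_eq,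
    Module.finrank_pi_fintype]
  simp

theorem isCompact_columns (n l : ℕ) :
    IsCompact {Θ : Params (M.p n) l | ∀ j, Θ j ∈ closure (M.S n)} := by
  refine Metric.isCompact_of_isClosed_isBounded ?_ ?_
  · simp only [Set.ofPred_forall]
    exact isClosed_iInter fun j => isClosed_closure.preimage (by fun_prop)
  · refine (Metric.isBounded_closedBall (x := 0) (r := l * (R : ℝ))).subset fun Θ hΘ => ?_
    rw [mem_closedBall_zero_iff]
    exact norm_params_le fun j => hM.norm_le_of_mem_closure_S n _ (hΘ j)

theorem convex_columns (n l : ℕ) :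
    Convex ℝ {Θ : Params (M.p n) l | ∀ j, Θ j ∈ closure (M.S n)} :=
  fun _ hx _ hy _ _ ha hb hab j => (hM.S_convex n).closure (hx j) (hy j) ha hb hab

/-- Variation of the empirical risk in terms of the averages of the absolute projections. -/
theorem empRisk_le_add {n : ℕ} {D : M.Data n} {C ε : ℝ} (hε : 0 < ε)
    (hD : ∀ θ ∈ closure (M.S n), M.avgProj n θ D ≤ C) {Θ Θ' Δ : Params (M.p n) k}
    (hΘ : ∀ j, Θ j ∈ M.S n) (hΘ' : ∀ j, Θ' j ∈ M.S n) (hΔ : ∀ j, Δ j ∈ closure (M.S n))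
    (hsub : Θ' - Θ = ε • Δ) :
    M.empRisk n D Θ' ≤ M.empRisk n D Θ + ε * (K * (k * C) + Kr (k * R + 1) * (k * R)) := by
  have hloss : (1 / (n : ℝ)) * ∑ i, M.sampleLoss n Θ' (D i)
      ≤ (1 / (n : ℝ)) * ∑ i, M.sampleLoss n Θ (D i) + ε * (K * (k * C)) := by
    calc (1 / (n : ℝ)) * ∑ i, M.sampleLoss n Θ' (D i)
        ≤ (1 / (n : ℝ)) * ∑ i, (M.sampleLoss n Θ (D i) + K * ∑ j, |⟪(Θ' - Θ) j, (D i).1⟫|) := by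
          refine mul_le_mul_of_nonneg_left (Finset.sum_le_sum fun i _ => ?_) (by positivity)
          have := (le_abs_self _).trans (hM.abs_sampleLoss_sub_le n Θ' Θ (D i))
          linarith
      _ = (1 / (n : ℝ)) * ∑ i, M.sampleLoss n Θ (D i)
          + K * ∑ j, M.avgProj n ((Θ' - Θ) j) D := by
          simp only [avgProj]
          rw [Finset.sum_add_distrib, mul_add, ← Finset.mul_sum, ← Finset.mul_sum,
            Finset.sum_comm]
          ring
      _ ≤ (1 / (n : ℝ)) * ∑ i, M.sampleLoss n Θ (D i) + K * ∑ _j : Fin k, ε * C := by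
          gcongr with j
          rw [hsub, PiLp.smul_apply, avgProj_smul, abs_of_pos hε]
          exact mul_le_mul_of_nonneg_left (hD _ (hΔ j)) hε.le
      _ = _ := by
          simp only [Finset.sum_const, Finset.card_univ, Fintype.card_fin, nsmul_eq_mul]
          ring
  have hreg : M.reg n Θ' ≤ M.reg n Θ + ε * (Kr (k * R + 1) * (k * R)) := by
    have hb : ∀ T : Params (M.p n) k, (∀ j, T j ∈ M.S n) → ‖T‖ ≤ ((k * R + 1 : ℝ≥0) : ℝ) := by
      intro T hT
      have := norm_params_le fun j => hM.norm_le_of_mem_closure_S n _ (subset_closure (hT j))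
      push_cast
      linarith
    -- The added `1` keeps the radius positive.
    have h1 := hM.reg_lipschitz n (k * R + 1) (by positivity) Θ' Θ (hb _ hΘ') (hb _ hΘ)
    have h2 : ‖Θ' - Θ‖ ≤ ε * (k * R) := by
      rw [hsub, norm_smul, Real.norm_of_nonneg hε.le]
      exact mul_le_mul_of_nonneg_left
        (norm_params_le fun j => hM.norm_le_of_mem_closure_S n _ (hΔ j)) hε.le
    have h3 := ((le_abs_self _).trans h1).trans (mul_le_mul_of_nonneg_left h2 (NNReal.coe_nonneg _))
    linarith
  simp only [empRisk]
  linarith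

/-- Asymptotic universality of the minimum of the empirical risk over arbitrary sets of
parameters. -/
theorem universality (hkstar : 0 < kstar) {c : ℝ} (hc : 0 < c)
    {P Q : ∀ n, Measure (EuclideanSpace ℝ (Fin (M.p n)))} (hP : M.Admissible c P)
    (hQ : M.Admissible c Q) (hPQ : CloseAlong M.S P Q)
    (hnoise : ∫⁻ e, ENNReal.ofReal (Real.exp (e ^ 2 / c ^ 2)) ∂M.noise ≤ 2)
    (A : ∀ n, Set (Params (M.p n) k)) (hA : ∀ n, ∀ Θ ∈ A n, ∀ j, Θ j ∈ M.S n)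
    {t α : ℝ} (htα : t < α) {δ : ℝ} (hδ : 0 < δ) :
    ∀ᶠ n in atTop, ∃ U V, MeasurableSet U ∧ MeasurableSet V ∧
      {D | ∃ Θ ∈ A n, M.empRisk n D Θ ≤ t} ⊆ U ∧ V ⊆ {D | ∃ Θ ∈ A n, M.empRisk n D Θ ≤ α} ∧
      (M.sampleLaw n (P n)).real U ≤ (M.sampleLaw n (Q n)).real V + δ := by
  have := hP.prob
  have := hQ.prob
  have := hM.noise_prob
  have hγ := hM.ratio_nonneg
  obtain ⟨C, hC0, hC⟩ := hM.exists_avgProj_le hc hP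
  -- The gap pays for the net (`e`), the width of the smooth step (`e`) and the soft minimum (`e`).
  set e := (α - t) / 4 with he
  have he0 : 0 < e := by rw [he]; linarith
  set L : ℝ := K * (k * C) + Kr (k * R + 1) * (k * R) with hL
  have hL0 : 0 ≤ L := by positivity
  set ε := e / (L + 1) with hε
  have hε0 : 0 < ε := by positivity
  have hεL : ε * L ≤ e := by
    rw [hε, div_mul_eq_mul_div, div_le_iff₀ (by positivity)]
    nlinarith
  set H := k * (γ + 1) * Real.log (1 + 2 / ε) with hH
  have hlog0 : 0 ≤ Real.log (1 + 2 / ε) := by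
    have : 0 ≤ 2 / ε := by positivity
    exact Real.log_nonneg (by linarith)
  have hH0 : 0 ≤ H := by positivity
  -- The log-cardinality of the net is at most `H * n`, so this `β` brings the soft-minimum error
  -- down to `e`; the added `1` keeps `β` positive.
  set β := (H + 1) / e with hβ
  have hβ0 : 0 < β := by positivity
  obtain ⟨ψ, ψ', Cψ, hCψ, hψc, hψ01, hψ1, hψ0, hψ', hψ''⟩ :=
    exists_smooth_step (show t + e < t + 2 * e by linarith)
  filter_upwards [hC (δ / 2) (half_pos hδ), hM.eventually_dim_le, eventually_gt_atTop 0,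
    hM.close_freeEnergy hkstar hc hP hQ hPQ hnoise hβ0 hCψ hψc hψ01 hψ' hψ'' (half_pos hδ)]
    with n htail hdim hn hfree
  have hn0 : (0 : ℝ) < n := by exact_mod_cast hn
  have hpP : IsProbabilityMeasure (M.sampleLaw n (P n)) := by unfold sampleLaw; infer_instance
  have hpQ : IsProbabilityMeasure (M.sampleLaw n (Q n)) := by unfold sampleLaw; infer_instance
  rcases (A n).eq_empty_or_nonempty with hAe | ⟨Θ₀, hΘ₀⟩
  · exact ⟨∅, ∅, .empty, .empty, by simp [hAe], by simp, by simpa using hδ.le⟩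
  -- The net lies in `A n`, so a net point of small risk is itself a witness, whatever the shape of
  -- `A n`. Discretization therefore costs only the inclusion under `P`, and projections need
  -- control only there.
  obtain ⟨N, hNmem, hNnet, hNcard⟩ := exists_gauge_net (hM.convex_columns n k)
    (fun x hx j => hM.neg_mem_closure_S n _ (hx j)) (hM.isCompact_columns n k) hε0 (A := A n)
    fun Θ hΘ j => subset_closure (hA n Θ hΘ j)
  have hne : Nonempty N := by
    obtain ⟨b, hb, -⟩ := hNnet Θ₀ hΘ₀
    exact ⟨⟨b, hb⟩⟩
  let Θ : N → Params (M.p n) k := fun i => i.1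
  have hΘS : ∀ i j, Θ i j ∈ M.S n := fun i => hA n _ (hNmem _ i.2)
  have hfr := hfree N Θ hΘS
  set F := M.freeEnergy n β Θ with hF
  have hFm : Measurable F := hM.measurable_freeEnergy n β Θ
  have hψi : ∀ (μ : Measure (M.Data n)) [IsProbabilityMeasure μ],
      Integrable (fun D => ψ (F D)) μ := fun μ _ =>
    Integrable.of_bound (hψc.measurable.comp hFm).aestronglyMeasurable 1 (ae_of_all _ fun D => by
      rw [Real.norm_of_nonneg (hψ01 _).1]; exact (hψ01 _).2)
  have hlow : {D | ∃ Θ ∈ A n, M.empRisk n D Θ ≤ t} ⊆ {D | 1 ≤ ψ (F D)}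
      ∪ {D | ∃ θ ∈ closure (M.S n), C < M.avgProj n θ D} := by
    rintro D ⟨Θ₁, hΘ₁, hle⟩
    by_cases hD : ∃ θ ∈ closure (M.S n), C < M.avgProj n θ D
    · exact Or.inr hD
    left
    push Not at hD
    obtain ⟨b, hbN, Δ, hΔ, hΔe⟩ := hNnet Θ₁ hΘ₁
    have hΔe' : ε • Δ = Θ₁ - b := hΔe
    have h1 := hM.empRisk_le_add hε0 hD (hA n _ hΘ₁) (hA n _ (hNmem b hbN))
      (Δ := -Δ) (fun j => hM.neg_mem_closure_S n _ (hΔ j)) (by rw [smul_neg, hΔe', neg_sub])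
    have h2 : F D ≤ M.empRisk n D b := freeEnergy_le Θ D hn hβ0 ⟨b, hbN⟩
    exact (hψ1 (F D) (by linarith)).ge
  have hup : {D | F D < t + 2 * e} ⊆ {D | ∃ Θ ∈ A n, M.empRisk n D Θ ≤ α} := by
    intro D hD
    obtain ⟨i, hi⟩ := exists_empRisk_le_freeEnergy_add Θ D hn hβ0
    refine ⟨Θ i, hNmem _ i.2, ?_⟩
    have hD' : F D < t + 2 * e := hD
    have hcard : Real.log (Fintype.card N) / (n * β) ≤ e := by
      have hNpos : (0 : ℝ) < Fintype.card N := by exact_mod_cast Fintype.card_pos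
      have hNcard' : (Fintype.card N : ℝ) ≤ (1 + 2 / ε) ^ (k * M.p n) := by
        rw [Fintype.card_coe, ← finrank_params]
        exact hNcard
      have h1 := Real.log_le_log hNpos hNcard'
      rw [Real.log_pow] at h1
      have h2 : ((k * M.p n : ℕ) : ℝ) * Real.log (1 + 2 / ε) ≤ H * n := by
        rw [hH]
        push_cast
        calc (k : ℝ) * M.p n * Real.log (1 + 2 / ε)
            ≤ k * ((γ + 1) * n) * Real.log (1 + 2 / ε) := by gcongr
          _ = _ := by ring
      rw [div_le_iff₀ (by positivity), hβ]
      calc _ ≤ H * n := h1.trans h2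
        _ ≤ (H + 1) * n := by gcongr; linarith
        _ = _ := by field_simp
    linarith
  have hPψ : (M.sampleLaw n (P n)).real {D | 1 ≤ ψ (F D)}
      ≤ ∫ D, ψ (F D) ∂(M.sampleLaw n (P n)) := by
    have := mul_meas_ge_le_integral_of_nonneg (μ := M.sampleLaw n (P n))
      (f := fun D => ψ (F D)) (ae_of_all _ fun D => (hψ01 _).1) (hψi _) 1
    rwa [one_mul] at this
  have hQψ : ∫ D, ψ (F D) ∂(M.sampleLaw n (Q n))
      ≤ (M.sampleLaw n (Q n)).real {D | F D < t + 2 * e} := by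
    have hms : MeasurableSet {D | F D < t + 2 * e} := measurableSet_lt hFm measurable_const
    rw [← integral_indicator_one hms]
    refine integral_mono (hψi _) ((integrable_const (1 : ℝ)).indicator hms) fun D => ?_
    by_cases hD : D ∈ {D | F D < t + 2 * e}
    · rw [Set.indicator_of_mem hD]
      exact (hψ01 _).2
    · rw [Set.indicator_of_notMem hD]
      exact (hψ0 _ (not_lt.1 hD)).le
  set W := {D | ∃ θ ∈ closure (M.S n), C < M.avgProj n θ D}
  -- Measurable bounds on both sides allow complements to be taken later without measurability of
  -- the events themselves.
  refine ⟨{D | 1 ≤ ψ (F D)} ∪ toMeasurable (M.sampleLaw n (P n)) W, {D | F D < t + 2 * e},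
    (measurableSet_le measurable_const (hψc.measurable.comp hFm)).union
      (measurableSet_toMeasurable _ _), measurableSet_lt hFm measurable_const,
    hlow.trans (Set.union_subset_union_right _ (subset_toMeasurable _ _)), hup, ?_⟩
  have h1 : (M.sampleLaw n (P n)).real (toMeasurable (M.sampleLaw n (P n)) W) ≤ δ / 2 := by
    rw [measureReal_def, measure_toMeasurable]
    exact htail
  have h2 := measureReal_union_le (μ := M.sampleLaw n (P n)) {D | 1 ≤ ψ (F D)}
    (toMeasurable (M.sampleLaw n (P n)) W)
  have h3 := (abs_le.1 hfr).2
  linarith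

end Assumptions

end ERMUniversality.ERMSequence

/-! ### Gaussian vectors are subgaussian -/

section Gaussian

/-- After rescaling to a standard normal `Y`, the integral is at most `E exp (Y² / 4) = √2`. -/
theorem lintegral_exp_sq_gaussianReal_le {v : ℝ≥0} {c : ℝ} (hc : 0 < c) (hv : 4 * v ≤ c ^ 2) :
    ∫⁻ y, ENNReal.ofReal (Real.exp (y ^ 2 / c ^ 2)) ∂(gaussianReal 0 v) ≤ 2 := by
  have hmap : gaussianReal 0 v = (gaussianReal 0 1).map (Real.sqrt v * ·) := by
    rw [gaussianReal_map_const_mul, mul_zero, mul_one]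
    congr 1
    ext
    simp
  have hm : ∀ a : ℝ, Measurable fun y : ℝ => ENNReal.ofReal (Real.exp (y ^ 2 / a)) := fun a =>
    Measurable.ennreal_ofReal (by fun_prop)
  rw [hmap, lintegral_map (hm _) (by fun_prop)]
  have hle : ∀ y : ℝ, (Real.sqrt v * y) ^ 2 / c ^ 2 ≤ y ^ 2 / 4 := fun y => by
    rw [mul_pow, Real.sq_sqrt (NNReal.coe_nonneg v), div_le_div_iff₀ (by positivity) (by norm_num)]
    nlinarith [sq_nonneg y]
  refine (lintegral_mono fun y => ENNReal.ofReal_le_ofReal (Real.exp_le_exp.2 (hle y))).trans ?_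
  rw [gaussianReal_of_var_ne_zero 0 one_ne_zero,
    lintegral_withDensity_eq_lintegral_mul _ (measurable_gaussianPDF 0 1) (hm 4)]
  have hprod : ∀ y : ℝ, (gaussianPDF 0 1 * fun y => ENNReal.ofReal (Real.exp (y ^ 2 / 4))) y
      = ENNReal.ofReal ((Real.sqrt (2 * Real.pi))⁻¹ * Real.exp (-(1 / 4) * y ^ 2)) := fun y => by
    rw [Pi.mul_apply, gaussianPDF, ← ENNReal.ofReal_mul (gaussianPDFReal_nonneg _ _ _),
      gaussianPDFReal]
    congr 1
    simp only [NNReal.coe_one, mul_one, sub_zero]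
    rw [mul_assoc, ← Real.exp_add]
    congr 2
    ring
  simp_rw [hprod]
  rw [← ofReal_integral_eq_lintegral_ofReal
    ((integrable_exp_neg_mul_sq (by norm_num)).const_mul _) (ae_of_all _ fun y => by positivity),
    integral_const_mul, integral_gaussian]
  rw [← ENNReal.ofReal_ofNat 2]
  refine ENNReal.ofReal_le_ofReal ?_
  rw [inv_mul_le_iff₀ (by positivity)]
  refine Real.sqrt_le_iff.2 ⟨by positivity, ?_⟩
  rw [mul_pow, Real.sq_sqrt (by positivity)]
  linarith [Real.pi_pos]

theorem map_inner_stdGaussian {E : Type*} [NormedAddCommGroup E] [InnerProductSpace ℝ E]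
    [FiniteDimensional ℝ E] [MeasurableSpace E] [BorelSpace E] (w : E) :
    (stdGaussian E).map (fun x => ⟪w, x⟫) = gaussianReal 0 (‖w‖ ^ 2).toNNReal := by
  have h := IsGaussian.map_eq_gaussianReal (μ := stdGaussian E) (innerSL ℝ w)
  rw [integral_strongDual_stdGaussian, variance_dual_stdGaussian, innerSL_apply_norm] at h
  exact h

theorem lintegral_exp_sq_multivariateGaussian_le {ι : Type*} [Fintype ι] [DecidableEq ι]
    (S : Matrix ι ι ℝ) (θ : EuclideanSpace ℝ ι) {c : ℝ} (hc : 0 < c)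
    (hθ : 2 * ‖Matrix.toEuclideanCLM (𝕜 := ℝ) (CFC.sqrt S) θ‖ ≤ c) :
    ∫⁻ x, ENNReal.ofReal (Real.exp (⟪θ, x⟫ ^ 2 / c ^ 2)) ∂(multivariateGaussian 0 S) ≤ 2 := by
  have hm : Measurable fun y : ℝ => ENNReal.ofReal (Real.exp (y ^ 2 / c ^ 2)) :=
    Measurable.ennreal_ofReal (by fun_prop)
  have hsa : IsSelfAdjoint (Matrix.toEuclideanCLM (𝕜 := ℝ) (CFC.sqrt S)) :=
    (CFC.sqrt_nonneg S).isSelfAdjoint.map _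
  set T := Matrix.toEuclideanCLM (𝕜 := ℝ) (CFC.sqrt S) with hT
  have hm' : Measurable fun x : EuclideanSpace ℝ ι =>
      ENNReal.ofReal (Real.exp (⟪θ, x⟫ ^ 2 / c ^ 2)) :=
    Measurable.ennreal_ofReal (Continuous.measurable (by fun_prop))
  rw [multivariateGaussian, lintegral_map hm' (by fun_prop), ← hT]
  have hinner : ∀ x, ⟪θ, 0 + T x⟫ = ⟪T θ, x⟫ := fun x => by
    rw [zero_add, ← ContinuousLinearMap.adjoint_inner_left, hsa.adjoint_eq]
  simp_rw [hinner]
  rw [← lintegral_map (g := fun x => ⟪T θ, x⟫) hm (Continuous.measurable (by fun_prop)),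
    map_inner_stdGaussian]
  refine lintegral_exp_sq_gaussianReal_le hc ?_
  rw [Real.coe_toNNReal _ (sq_nonneg _)]
  nlinarith [norm_nonneg (T θ)]

end Gaussian

/-! ### Comparison of the tails of the minimum test error -/

namespace ERMUniversality.ERMSequence

variable {k kstar : ℕ} {M : ERMSequence k kstar} {γ : ℝ} {R K : ℝ≥0} {Kr : ℝ≥0 → ℝ≥0}

theorem minTestError_le_of_mem {n : ℕ} {μ : Measure (EuclideanSpace ℝ (Fin (M.p n)))} {t : ℝ}
    {D : M.Data n} {Θ : Params (M.p n) k} (h : Θ ∈ M.ERM n t D) :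
    M.minTestError n μ t D ≤ (M.testError n μ Θ : EReal) :=
  iInf₂_le Θ h

theorem exists_testError_lt {n : ℕ} {μ : Measure (EuclideanSpace ℝ (Fin (M.p n)))} {t a : ℝ}
    {D : M.Data n} (h : M.minTestError n μ t D < (a : EReal)) :
    ∃ Θ ∈ M.ERM n t D, M.testError n μ Θ < a := by
  simp only [minTestError, iInf_lt_iff] at h
  obtain ⟨Θ, hΘ, hlt⟩ := h
  exact ⟨Θ, hΘ, EReal.coe_lt_coe_iff.1 hlt⟩

namespace Assumptions

variable (hM : M.Assumptions γ R K Kr)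
include hM

/-- The assumptions concern directions in the unit ball; dividing by `max R 1` brings every
direction there without leaving the set. Replacing `K` by `2 * K` turns a bound on an infimum into a
strict one, and leaves the room required for Gaussians. -/
theorem exists_admissible (hkstar : 0 < kstar) (hK : 0 < K) : ∃ c : ℝ, 0 < c ∧
    M.Admissible c M.features ∧ M.Admissible c M.gaussian ∧
    ∫⁻ e, ENNReal.ofReal (Real.exp (e ^ 2 / c ^ 2)) ∂M.noise ≤ 2 := by
  set r : ℝ≥0 := max R 1 with hr
  have hr1 : 1 ≤ r := le_max_right _ _
  have hr0 : (0 : ℝ) < r := by exact_mod_cast zero_lt_one.trans_le hr1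
  have hK0 : (0 : ℝ) < K := hK
  have h2K : (K : ℝ≥0∞) < (2 * K : ℝ≥0) := by
    rw [ENNReal.coe_lt_coe, two_mul]
    exact lt_add_of_pos_left _ hK
  have hscale : ∀ n, ∀ θ ∈ M.S n, (r : ℝ)⁻¹ • θ ∈ M.S n ∧ ‖(r : ℝ)⁻¹ • θ‖ ≤ 1 := by
    intro n θ hθ
    have hr1' : (1 : ℝ) ≤ r := hr1
    refine ⟨(hM.S_convex n).smul_mem_of_zero_mem (hM.zero_mem hkstar n) hθ
      ⟨by positivity, inv_le_one_of_one_le₀ hr1'⟩, ?_⟩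
    rw [norm_smul, Real.norm_of_nonneg (by positivity), inv_mul_le_iff₀ hr0, mul_one]
    have h1 : ‖θ‖ ≤ R := by simpa using hM.S_subset n hθ
    exact h1.trans (by exact_mod_cast le_max_left R 1)
  have heq : ∀ n, ∀ θ x : EuclideanSpace ℝ (Fin (M.p n)),
      ⟪θ, x⟫ ^ 2 / (2 * K * r : ℝ) ^ 2 = ⟪(r : ℝ)⁻¹ • θ, x⟫ ^ 2 / ((2 * K : ℝ≥0) : ℝ) ^ 2 := by
    intro n θ x
    rw [real_inner_smul_left]
    push_cast
    field_simp
  refine ⟨2 * K * r, by positivity, ⟨hM.features_prob, fun n θ hθ => ?_⟩,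
    ⟨fun n => ?_, fun n θ hθ => ?_⟩, ?_⟩
  · simp_rw [heq]
    exact lintegral_exp_sq_le_of_subgaussianNorm_lt
      ((hM.features_subgaussian n _ (hscale n θ hθ).1 (hscale n θ hθ).2).trans_lt h2K)
  · unfold gaussian
    infer_instance
  · simp_rw [heq]
    refine lintegral_exp_sq_multivariateGaussian_le _ _ (by positivity) ?_
    have := hM.cov_bounded n _ (hscale n θ hθ).1 (hscale n θ hθ).2
    push_cast
    linarith
  · have hKr : (K : ℝ≥0∞) < (2 * K * r : ℝ≥0) := h2K.trans_le
      (ENNReal.coe_le_coe.2 (le_mul_of_one_le_right' hr1))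
    simpa using lintegral_exp_sq_le_of_subgaussianNorm_lt (hM.noise_subgaussian.trans_lt hKr)

theorem closeAlong_gaussian : CloseAlong M.S M.features M.gaussian := by
  intro φ hL hB ε hε
  have := hM.features_prob
  have hg : ∀ n, IsProbabilityMeasure (M.gaussian n) := fun n => by
    unfold gaussian
    infer_instance
  filter_upwards [(hM.features_gaussian φ hL hB).eventually (eventually_lt_nhds hε)] with n hn θ hθ
  obtain ⟨B, hB⟩ := hB
  have hint : ∀ (μ : Measure (EuclideanSpace ℝ (Fin (M.p n)))) [IsProbabilityMeasure μ]
      (θ : EuclideanSpace ℝ (Fin (M.p n))), |∫ x, φ ⟪θ, x⟫ ∂μ| ≤ B := fun μ _ θ => by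
    have := norm_integral_le_of_norm_le_const (μ := μ) (f := fun x => φ ⟪θ, x⟫) (C := B)
      (ae_of_all _ fun x => hB _)
    simpa using this
  have hbdd : BddAbove (Set.range fun θ : M.S n =>
      |∫ x, φ ⟪(θ : EuclideanSpace ℝ (Fin (M.p n))), x⟫ ∂(M.features n)
        - ∫ g, φ ⟪(θ : EuclideanSpace ℝ (Fin (M.p n))), g⟫ ∂(M.gaussian n)|) := by
    refine ⟨B + B, ?_⟩
    rintro _ ⟨θ, rfl⟩
    exact (abs_sub _ _).trans (add_le_add (hint _ _) (hint _ _))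
  exact (le_ciSup hbdd ⟨θ, hθ⟩).trans hn.le

/-- Comparison of the upper tails of the minimum test errors. -/
theorem eventually_prob_ge_le (hkstar : 0 < kstar) (hK : 0 < K) {δ α η : ℝ} (hδ : 0 < δ)
    (hα : 0 < α) (hη : 0 < η) (ρ : ℝ) :
    ∀ᶠ n in atTop, M.prob n (M.features n) α (fun v => ((ρ + δ : ℝ) : EReal) ≤ v)
      ≤ M.prob n (M.gaussian n) 0 (fun v => (ρ : EReal) < v) + η := by
  obtain ⟨c, hc, hP, hQ, hnoise⟩ := hM.exists_admissible hkstar hK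
  have hPp := hP.prob
  have hQp := hQ.prob
  have := hM.noise_prob
  have hPQ := hM.closeAlong_gaussian
  -- The Gaussian law plays the first role here, and complements turn this into a bound on upper
  -- tails. The infimum need not be attained, which uses `δ / 2`; exchanging test errors uses `δ /
  -- 4`.
  filter_upwards [hM.universality hkstar hc hQ hP hPQ.symm hnoise
    (fun n => {Θ | (∀ j, Θ j ∈ M.C n) ∧ M.testError n (M.gaussian n) Θ ≤ ρ + δ / 2})
    (fun n Θ hΘ j => hM.C_subset n (hΘ.1 j)) hα hη,
    hM.close_testError hkstar hc hP hQ hPQ hnoise (show 0 < δ / 4 by positivity)]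
    with n ⟨U, V, hU, hV, hsubU, hsubV, hUV⟩ hclose
  have i1 : IsProbabilityMeasure (M.sampleLaw n (M.features n)) := by
    unfold sampleLaw; infer_instance
  have i2 : IsProbabilityMeasure (M.sampleLaw n (M.gaussian n)) := by
    unfold sampleLaw; infer_instance
  have h1 : {D | ((ρ + δ : ℝ) : EReal) ≤ M.minTestError n (M.features n) α D} ⊆ Vᶜ := by
    intro D hD hDV
    obtain ⟨Θ, ⟨hΘC, hΘe⟩, hΘr⟩ := hsubV hDV
    have h := (le_trans hD (minTestError_le_of_mem (μ := M.features n) ⟨hΘC, hΘr⟩))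
    have h' := EReal.coe_le_coe_iff.1 h
    have := (abs_le.1 (hclose Θ fun j => hM.C_subset n (hΘC j))).2
    linarith
  have h2 : Uᶜ ⊆ {D | (ρ : EReal) < M.minTestError n (M.gaussian n) 0 D} := by
    intro D hD
    by_contra hcon
    apply hD
    have hlt : M.minTestError n (M.gaussian n) 0 D < ((ρ + δ / 2 : ℝ) : EReal) :=
      (not_lt.1 hcon).trans_lt (EReal.coe_lt_coe_iff.2 (by linarith))
    obtain ⟨Θ, hΘ, hΘe⟩ := exists_testError_lt hlt
    exact hsubU ⟨Θ, ⟨hΘ.1, hΘe.le⟩, hΘ.2⟩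
  have h3 := measureReal_mono (μ := M.sampleLaw n (M.features n)) h1
  have h4 := measureReal_mono (μ := M.sampleLaw n (M.gaussian n)) h2
  rw [probReal_compl_eq_one_sub hV] at h3
  rw [probReal_compl_eq_one_sub hU] at h4
  simp only [prob]
  linarith

/-- Comparison of the lower tails of the minimum test errors. -/
theorem eventually_prob_le_le (hkstar : 0 < kstar) (hK : 0 < K) {δ t α η : ℝ} (hδ : 0 < δ)
    (htα : t < α) (hη : 0 < η) (ρ : ℝ) :
    ∀ᶠ n in atTop, M.prob n (M.features n) t (fun v => v ≤ ((ρ - δ : ℝ) : EReal))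
      ≤ M.prob n (M.gaussian n) α (fun v => v ≤ (ρ : EReal)) + η := by
  obtain ⟨c, hc, hP, hQ, hnoise⟩ := hM.exists_admissible hkstar hK
  have hPp := hP.prob
  have hQp := hQ.prob
  have := hM.noise_prob
  have hPQ := hM.closeAlong_gaussian
  -- Half of `δ` selects a near-minimizer, the other half passes from its test error under the
  -- features to the Gaussian one.
  filter_upwards [hM.universality hkstar hc hP hQ hPQ hnoise
    (fun n => {Θ | (∀ j, Θ j ∈ M.C n) ∧ M.testError n (M.gaussian n) Θ ≤ ρ})
    (fun n Θ hΘ j => hM.C_subset n (hΘ.1 j)) htα hη,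
    hM.close_testError hkstar hc hP hQ hPQ hnoise (half_pos hδ)]
    with n ⟨U, V, hU, hV, hsubU, hsubV, hUV⟩ hclose
  have i1 : IsProbabilityMeasure (M.sampleLaw n (M.features n)) := by
    unfold sampleLaw; infer_instance
  have i2 : IsProbabilityMeasure (M.sampleLaw n (M.gaussian n)) := by
    unfold sampleLaw; infer_instance
  have h1 : {D | M.minTestError n (M.features n) t D ≤ ((ρ - δ : ℝ) : EReal)} ⊆ U := by
    intro D hD
    have hlt : M.minTestError n (M.features n) t D < ((ρ - δ / 2 : ℝ) : EReal) :=
      lt_of_le_of_lt hD (EReal.coe_lt_coe_iff.2 (by linarith))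
    obtain ⟨Θ, hΘ, hΘe⟩ := exists_testError_lt hlt
    have := (abs_le.1 (hclose Θ fun j => hM.C_subset n (hΘ.1 j))).1
    exact hsubU ⟨Θ, ⟨hΘ.1, by linarith⟩, hΘ.2⟩
  have h2 : V ⊆ {D | M.minTestError n (M.gaussian n) α D ≤ (ρ : EReal)} := by
    intro D hD
    obtain ⟨Θ, ⟨hΘC, hΘe⟩, hΘr⟩ := hsubV hD
    exact (minTestError_le_of_mem ⟨hΘC, hΘr⟩).trans (EReal.coe_le_coe_iff.2 hΘe)
  have h3 := measureReal_mono (μ := M.sampleLaw n (M.features n)) h1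
  have h4 := measureReal_mono (μ := M.sampleLaw n (M.gaussian n)) h2
  simp only [prob]
  linarith

end Assumptions

end ERMUniversality.ERMSequence

/-! ### Limits superior and conclusion -/

theorem limsup_le_of_forall_eventually_le {ι : Type*} {f : Filter ι} [f.NeBot] {u : ι → ℝ}
    {a b : ℝ} (hb : ∀ i, b ≤ u i) (h : ∀ η > 0, ∀ᶠ i in f, u i ≤ a + η) : limsup u f ≤ a :=
  le_of_forall_pos_le_add fun η hη =>
    limsup_le_of_le (isCoboundedUnder_le_of_le f hb) (h η hη)

theorem le_limsup_of_forall_le {ι : Type*} {f : Filter ι} [f.NeBot] {u : ι → ℝ}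
    {a b : ℝ} (ha : ∀ i, u i ≤ a) (hb : ∀ i, b ≤ u i) : b ≤ limsup u f :=
  le_limsup_of_frequently_le (Frequently.of_forall hb)
    (isBoundedUnder_of ⟨a, ha⟩)

theorem theorem2 (k kstar : ℕ) (hk : 0 < k) (hkstar : 0 < kstar)
    (γ : ℝ) (hγ : 0 < γ) (R K : ℝ≥0) (hR : 0 < R) (hK : 0 < K) (Kr : ℝ≥0 → ℝ≥0)
    (M : ERMUniversality.ERMSequence k kstar) (hM : M.Assumptions γ R K Kr)
    (hinterp : Tendsto
      (fun n => (M.sampleLaw n (M.gaussian n)).real {D | (M.ERM n 0 D).Nonempty})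
      atTop (𝓝 1)) :
    (∀ δ > 0, ∀ α > 0, ∀ ρ : ℝ,
      limsup (fun n =>
        M.prob n (M.features n) α (fun v => ((ρ + δ : ℝ) : EReal) ≤ v)
          - M.prob n (M.gaussian n) 0 (fun v => (ρ : EReal) < v)) atTop ≤ 0 ∧
      limsup (fun t => limsup (fun n =>
        M.prob n (M.features n) t (fun v => v ≤ ((ρ - δ : ℝ) : EReal))
          - M.prob n (M.gaussian n) α (fun v => v ≤ (ρ : EReal))) atTop) (𝓝[≠] 0) ≤ 0) ∧
    (∀ ρ : ℝ,
      (∀ δ > 0, Tendsto (fun n =>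
        M.prob n (M.gaussian n) 0 (ERMUniversality.Far ρ δ)) atTop (𝓝 0)) →
      (∀ δ > 0, Tendsto (fun α => limsup (fun n =>
        M.prob n (M.gaussian n) α (ERMUniversality.Far ρ δ)) atTop) (𝓝[>] 0) (𝓝 0)) →
      ∀ δ > 0, Tendsto (fun t => limsup (fun n =>
        M.prob n (M.features n) t (ERMUniversality.Far ρ δ)) atTop) (𝓝[>] 0) (𝓝 0)) := by
  have hPp := hM.features_prob
  have hnp := hM.noise_prob
  have i1 : ∀ n, IsProbabilityMeasure (M.sampleLaw n (M.features n)) := fun n => by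
    unfold ERMUniversality.ERMSequence.sampleLaw; infer_instance
  have i2 : ∀ n, IsProbabilityMeasure (M.sampleLaw n (M.gaussian n)) := fun n => by
    unfold ERMUniversality.ERMSequence.sampleLaw ERMUniversality.ERMSequence.gaussian
    infer_instance
  have hP0 : ∀ n t A, 0 ≤ M.prob n (M.features n) t A := fun n t A => measureReal_nonneg
  have hQ0 : ∀ n t A, 0 ≤ M.prob n (M.gaussian n) t A := fun n t A => measureReal_nonneg
  have hP1 : ∀ n t A, M.prob n (M.features n) t A ≤ 1 := fun n t A => measureReal_le_one
  have hQ1 : ∀ n t A, M.prob n (M.gaussian n) t A ≤ 1 := fun n t A => measureReal_le_one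
  refine ⟨fun δ hδ α hα ρ => ⟨?_, ?_⟩, fun ρ hρ0 hρα δ hδ => ?_⟩
  · refine limsup_le_of_forall_eventually_le (b := -1) (fun n => ?_) fun η hη => ?_
    · linarith [hP0 n α fun v => ((ρ + δ : ℝ) : EReal) ≤ v, hQ1 n 0 fun v => (ρ : EReal) < v]
    · filter_upwards [hM.eventually_prob_ge_le hkstar hK hδ hα hη ρ] with n hn
      linarith
  · have hlow : ∀ t n, -1 ≤ M.prob n (M.features n) t (fun v => v ≤ ((ρ - δ : ℝ) : EReal))
        - M.prob n (M.gaussian n) α (fun v => v ≤ (ρ : EReal)) := fun t n => by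
      linarith [hP0 n t fun v => v ≤ ((ρ - δ : ℝ) : EReal),
        hQ1 n α fun v => v ≤ (ρ : EReal)]
    have hup : ∀ t n, M.prob n (M.features n) t (fun v => v ≤ ((ρ - δ : ℝ) : EReal))
        - M.prob n (M.gaussian n) α (fun v => v ≤ (ρ : EReal)) ≤ 1 := fun t n => by
      linarith [hP1 n t fun v => v ≤ ((ρ - δ : ℝ) : EReal),
        hQ0 n α fun v => v ≤ (ρ : EReal)]
    refine limsup_le_of_forall_eventually_le (b := -1)
      (fun t => le_limsup_of_forall_le (hup t) (hlow t)) fun η hη => ?_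
    have ht : ∀ᶠ t : ℝ in 𝓝[≠] 0, t < α :=
      eventually_nhdsWithin_of_eventually_nhds (eventually_lt_nhds hα)
    filter_upwards [ht] with t ht
    have h0 := limsup_le_of_forall_eventually_le (f := atTop) (a := 0) (hlow t) fun η hη => by
      filter_upwards [hM.eventually_prob_le_le hkstar hK hδ ht hη ρ] with n hn
      linarith
    linarith
  · have hnn : ∀ t, 0 ≤ limsup (fun n => M.prob n (M.features n) t
        (ERMUniversality.Far ρ δ)) atTop := fun t =>
      le_limsup_of_forall_le (fun n => hP1 n t _) fun n => hP0 n t _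
    rw [Metric.tendsto_nhds]
    intro ε hε
    have hη : 0 < ε / 5 := by positivity
    -- A single accuracy `α` of Gaussian interpolation suffices; it then serves all `t` in `(0, α)`.
    obtain ⟨α, hαlim, hα⟩ := (((hρα (δ / 2) (half_pos hδ)).eventually
      (eventually_lt_nhds hη)).and eventually_mem_nhdsWithin).exists
    have hα0 : (0 : ℝ) < α := hα
    have hαn := eventually_lt_of_limsup_lt hαlim (isBoundedUnder_of ⟨1, fun n => hQ1 n α _⟩)
    have ht : ∀ᶠ t : ℝ in 𝓝[>] 0, t < α :=
      eventually_nhdsWithin_of_eventually_nhds (eventually_lt_nhds hα0)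
    filter_upwards [ht, eventually_mem_nhdsWithin] with t htα ht0
    have ht0' : (0 : ℝ) < t := ht0
    rw [Real.dist_eq, sub_zero, abs_of_nonneg (hnn t)]
    refine lt_of_le_of_lt (limsup_le_of_le (a := 4 * (ε / 5))
      (isCoboundedUnder_le_of_le atTop fun n => hP0 n t _) ?_) (by linarith)
    -- The upper tail is compared with exact Gaussian interpolation, using `0 < t`, and the lower
    -- tail with accuracy `α`, using `t < α`. Two Gaussian tails and two comparison errors cost `ε /
    -- 5` each.
    filter_upwards [hαn, (hρ0 (δ / 2) (half_pos hδ)).eventually (eventually_lt_nhds hη),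
      hM.eventually_prob_ge_le hkstar hK (half_pos hδ) ht0' hη (ρ + δ / 2),
      hM.eventually_prob_le_le hkstar hK (half_pos hδ) htα hη (ρ - δ / 2)] with n h1 h2 h3 h4
    rw [show ρ + δ / 2 + δ / 2 = ρ + δ by ring] at h3
    rw [show ρ - δ / 2 - δ / 2 = ρ - δ by ring] at h4
    have hunion : M.prob n (M.features n) t (ERMUniversality.Far ρ δ)
        ≤ M.prob n (M.features n) t (fun v => v ≤ ((ρ - δ : ℝ) : EReal))
          + M.prob n (M.features n) t (fun v => ((ρ + δ : ℝ) : EReal) ≤ v) :=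
      measureReal_union_le _ _
    have h5 : M.prob n (M.gaussian n) 0 (fun v => ((ρ + δ / 2 : ℝ) : EReal) < v)
        ≤ M.prob n (M.gaussian n) 0 (ERMUniversality.Far ρ (δ / 2)) :=
      measureReal_mono fun D hD => Or.inr (le_of_lt hD)
    have h6 : M.prob n (M.gaussian n) α (fun v => v ≤ ((ρ - δ / 2 : ℝ) : EReal))
        ≤ M.prob n (M.gaussian n) α (ERMUniversality.Far ρ (δ / 2)) :=
      measureReal_mono fun D hD => Or.inl hD
    linarith
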